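/- **Setting.** Fix a set $\mathcal C_T$ of type-level constants, a set $\mathcal F_T$ of type-level function symbols and a set $\mathcal F_o$ of object-level function symbols. Terms are $$K ::= \mathsf{Type}\mid (x:U)\to K,\qquad T,U ::= \lambda x{:}U.\,T\mid (x:U)\to T\mid U\,t\mid D\mid F,\qquad t,u ::= x\mid \lambda x{:}U.\,t\mid t\,u\mid f$$ (kinds, types, objects; $D\in\mathcal C_T$, $F\in\mathcal F_T$, $f\in\mathcal F_o$). A function $\tau$ gives a kind to each symbol of $\mathcal C_T\cup\mathcal F_T$ and a type to each symbol of $\mathcal F_o$; the arity of a symbol is the number of leading arrows of its type or kind. A *constructor* is an $f\in\mathcal F_o$ with $\tau(f)=(x_1:T_1)\to\dots\to(x_n:T_n)\to U$ where $U$ and all $T_i$ are of the form $D\,u_1\dots u_{m}$ with $D\in\mathcal C_T$ of arity $m$. *Patterns* are $p::=x\mid c\,p_1\dots p_{n}$ with $c$ a constructor of arity $n$. Let $\mathcal R$ be a set of rules $f\,p_1\dots p_n\to r$ with $f\in\mathcal F_T\cup\mathcal F_o$ of arity $n$, patterns $p_i$, and $r$ a $\beta$-normal term of the same level (type or object) as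 $f$; assume that only finitely many symbols head a rule (constructors may be among them). Let $\to$ be the union of $\beta$-reduction and of the smallest rewrite relation containing $\mathcal R$, and $\leftrightarrow^*$ the equivalence it generates. Typing $\Gamma\vdash t:A$ is that of LF (a symbol $f$ having type $\tau(f)$ if $\tau(f)$ is itself well formed in the empty context), with the conversion rule: from $\Gamma\vdash t:A$, $\Gamma\vdash A:s$, $\Gamma\vdash B:s$ and $A\leftrightarrow^*B$, with $s\in\{\mathsf{Type},\mathsf{Kind}\}$, infer $\Gamma\vdash t:B$. **Calls and size-change termination.** Let $f\,\bar p>_{call}g\,\bar t$ if there is a rule $f\,\bar p\to r$ in $\mathcal R$ such that $g\in\mathcal F_T\cup\mathcal F_o$ and $g\,\bar t$ is a subterm of $r$ with $|\bar t|$ the arity of $g$. Let $\lhd$ be the smallest transitive relation with $t_i\lhd c\,t_1\dots t_n$ for $c$ a constructor. The call $f\,\bar p>_{call}g\,\bar t$ is an edge from $f$ to $g$ labelled with the matrix $(a_{i,j})$ where $a_{i,j}=-1$ if $t_j\lhd p_i$, $a_{i,j}=0$ if $t_j=p_i$, and $a_{i,j}=\infty$ otherwise. Edges compose by the matrix product over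 $\{-1,0,\infty\}$ whose sum is the minimum and whose product is addition truncated below at $-1$. $\mathcal R$ satisfies *size-change termination* if in the transitive closure of this graph every edge from a node to itself has a $-1$ on the diagonal of its matrix. **Computability closure.** For a left-hand side $f\,\bar p$, let $CC_{>_{call}}(f\,\bar p)$ be the smallest set of typed terms $\Gamma\vdash_c t:A$ ($\Gamma$ declaring the variables bound above $t$) such that: a variable of $\bar p$ has any type expected at one of its occurrences, that is, $T_i[\bar p]$ if it is the $i$-th argument of $f$ or of a constructor with argument types $T_i$; it is closed under the LF rules for bound variables, type-level constants, products, abstractions and applications and under conversion modulo $\leftrightarrow^*$; and, if $f\,\bar p>_{call}g\,\bar u$, $\tau(g)=(\bar y:\bar U)\to V$ is well formed, and $\Gamma\vdash_c u_i:U_i[\bar u]$ for all $i$, then $\Gamma\vdash_c g\,\bar u:V[\bar u]$. This is the only rule that introduces function symbols. $\mathcal R$ satisfies $CC_{>_{call}}$ if for every rule $f\,\bar p\to r$, with $\tau(f)=(\bar x:\bar T)\to U$, one has $\vdash_c r:U[\bar p]$ in $CC_{>_{call}}(f\,\bar p)$. **Proposition.** Suppose that ${\to}={\to_\beta\cup\to_{\mathcal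 R}}$ is confluent and preserves typing. If $\mathcal R$ satisfies $CC_{>_{call}}$ and size-change termination, then $\to$ is strongly normalizing on every term (object, type or kind) that is typable in the $\lambda\Pi$-calculus modulo $\leftrightarrow^*$. -/

import Mathlib

universe u v

namespace LambdaPi

/-! ### Terms

Variables are de Bruijn indices and stand for objects only.  The signature is given by a type `C` of
type-level constants and a family `F` of function symbols: `F .ty` are the type-level ones and
`F .obj` the object-level ones. -/

/-- The two levels of terms that can head an application. -/
inductive Lvl
  | obj
  | ty

/-- Object-level terms (`l = .obj`) and type-level terms (`l = .ty`). `lam U t` and `pi U T` bind one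
variable in `t`, `T`. -/
inductive Term (C : Type u) (F : Lvl → Type v) : Lvl → Type (max u v)
  | var (n : ℕ) : Term C F .obj
  | fn {l : Lvl} (f : F l) : Term C F l
  | con (D : C) : Term C F .ty
  | lam {l : Lvl} (U : Term C F .ty) (t : Term C F l) : Term C F l
  | app {l : Lvl} (t : Term C F l) (u : Term C F .obj) : Term C F l
  | pi (U T : Term C F .ty) : Term C F .ty

/-- Kind-level terms `Type` and `(x : U) → K`. -/
inductive Kd (C : Type u) (F : Lvl → Type v) : Type (max u v)
  | type : Kd C F
  | pi (U : Term C F .ty) (K : Kd C F) : Kd C F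

abbrev Obj (C : Type u) (F : Lvl → Type v) := Term C F .obj
abbrev Ty (C : Type u) (F : Lvl → Type v) := Term C F .ty

/-- Function symbols of both levels. -/
abbrev Sym (F : Lvl → Type v) := Σ l : Lvl, F l

variable {C : Type u} {F : Lvl → Type v}

/-! ### Renaming and substitution -/

/-- Lifting of a renaming under a binder. -/
def liftRen (ξ : ℕ → ℕ) : ℕ → ℕ
  | 0 => 0
  | n + 1 => ξ n + 1

def Term.rename : {l : Lvl} → (ℕ → ℕ) → Term C F l → Term C F l
  | _, ξ, .var n => .var (ξ n)
  | _, _, .fn f => .fn f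
  | _, _, .con D => .con D
  | _, ξ, .lam U t => .lam (U.rename ξ) (t.rename (liftRen ξ))
  | _, ξ, .app t u => .app (t.rename ξ) (u.rename ξ)
  | _, ξ, .pi U T => .pi (U.rename ξ) (T.rename (liftRen ξ))

/-- Weakening by `k` variables. -/
def Term.shift {l : Lvl} (k : ℕ) (t : Term C F l) : Term C F l := t.rename (· + k)

/-- Lifting of a substitution under a binder. -/
def liftSub (σ : ℕ → Obj C F) : ℕ → Obj C F
  | 0 => .var 0
  | n + 1 => (σ n).shift 1

/-- Simultaneous capture-avoiding substitution. -/
def Term.subst : {l : Lvl} → (ℕ → Obj C F) → Term C F l → Term C F l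
  | _, σ, .var n => σ n
  | _, _, .fn f => .fn f
  | _, _, .con D => .con D
  | _, σ, .lam U t => .lam (U.subst σ) (t.subst (liftSub σ))
  | _, σ, .app t u => .app (t.subst σ) (u.subst σ)
  | _, σ, .pi U T => .pi (U.subst σ) (T.subst (liftSub σ))

def Kd.subst (σ : ℕ → Obj C F) : Kd C F → Kd C F
  | .type => .type
  | .pi U K => .pi (U.subst σ) (K.subst (liftSub σ))

/-- The substitution that replaces the last bound variable by `u`. -/
def single (u : Obj C F) : ℕ → Obj C F
  | 0 => u
  | n + 1 => .var n

def Term.inst {l : Lvl} (t : Term C F l) (u : Obj C F) : Term C F l := t.subst (single u)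
def Kd.inst (K : Kd C F) (u : Obj C F) : Kd C F := K.subst (single u)

/-- `apps t [u₁, …, uₙ] = t u₁ … uₙ`. -/
def apps {l : Lvl} : Term C F l → List (Obj C F) → Term C F l
  | t, [] => t
  | t, u :: us => apps (.app t u) us

/-! ### Signatures, arities, constructors, patterns -/

/-- The function `τ`: a kind for every type-level symbol, a type for every object-level symbol. -/
structure Sig (C : Type u) (F : Lvl → Type v) where
  con : C → Kd C F
  tyFn : F .ty → Kd C F
  objFn : F .obj → Ty C F

/-- The number of leading arrows of a type. -/
def Term.arity : {l : Lvl} → Term C F l → ℕ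
  | _, .pi _ T => T.arity + 1
  | _, _ => 0

/-- The number of leading arrows of a kind. -/
def Kd.arity : Kd C F → ℕ
  | .type => 0
  | .pi _ K => K.arity + 1

/-- The arity of a function symbol. -/
def Sig.arity (S : Sig C F) : Sym F → ℕ
  | ⟨.ty, f⟩ => (S.tyFn f).arity
  | ⟨.obj, f⟩ => (S.objFn f).arity

/-- `T` is `D u₁ … uₙ` with `D` a type-level constant of arity `n`. -/
def Sig.IsData (S : Sig C F) (T : Ty C F) : Prop :=
  ∃ (D : C) (us : List (Obj C F)), us.length = (S.con D).arity ∧ T = apps (.con D) us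

/-- `T` is `(x₁ : T₁) → … → (xₙ : Tₙ) → U` with all the `Tᵢ` and `U` of the form `D u₁ … uₙ`. -/
inductive Sig.IsCtorType (S : Sig C F) : Ty C F → Prop
  | data {U : Ty C F} : S.IsData U → S.IsCtorType U
  | arrow {T U : Ty C F} : S.IsData T → S.IsCtorType U → S.IsCtorType (.pi T U)

/-- The set of constructors. A constructor may well head rewrite rules. -/
def Sig.IsCtor (S : Sig C F) (c : F .obj) : Prop := S.IsCtorType (S.objFn c)

inductive Sig.IsPattern (S : Sig C F) : Obj C F → Prop
  | var (n : ℕ) : S.IsPattern (.var n)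
  | ctor (c : F .obj) (ps : List (Obj C F)) : S.IsCtor c → ps.length = S.arity ⟨.obj, c⟩ →
      (∀ p ∈ ps, S.IsPattern p) → S.IsPattern (apps (.fn c) ps)

/-! ### Rewriting -/

/-- A set of rules: `R f [p₁, …, pₙ] r` means that `f p₁ … pₙ → r` is a rule. The two sides have the
same level. The pattern variables of the rule are its de Bruijn indices. -/
abbrev Rules (C : Type u) (F : Lvl → Type v) :=
  ∀ ⦃l : Lvl⦄, F l → List (Obj C F) → Term C F l → Prop

/-- The union of `β`-reduction and of the smallest rewrite relation containing `R`. -/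
inductive Step (R : Rules C F) : {l : Lvl} → Term C F l → Term C F l → Prop
  | beta {l : Lvl} (U : Ty C F) (t : Term C F l) (u : Obj C F) :
      Step R (.app (.lam U t) u) (t.inst u)
  | rule {l : Lvl} {f : F l} {ps : List (Obj C F)} {r : Term C F l} (σ : ℕ → Obj C F) :
      R f ps r → Step R (apps (.fn f) (ps.map (Term.subst σ))) (r.subst σ)
  | lamDom {l : Lvl} {U U' : Ty C F} (t : Term C F l) :
      Step R U U' → Step R (.lam U t) (.lam U' t)
  | lamBody {l : Lvl} (U : Ty C F) {t t' : Term C F l} :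
      Step R t t' → Step R (.lam U t) (.lam U t')
  | appFun {l : Lvl} {t t' : Term C F l} (u : Obj C F) :
      Step R t t' → Step R (.app t u) (.app t' u)
  | appArg {l : Lvl} (t : Term C F l) {u u' : Obj C F} :
      Step R u u' → Step R (.app t u) (.app t u')
  | piDom {U U' : Ty C F} (T : Ty C F) : Step R U U' → Step R (.pi U T) (.pi U' T)
  | piCod (U : Ty C F) {T T' : Ty C F} : Step R T T' → Step R (.pi U T) (.pi U T')

/-- The same relation on kinds. -/
inductive KStep (R : Rules C F) : Kd C F → Kd C F → Prop
  | piDom {U U' : Ty C F} (K : Kd C F) : Step R U U' → KStep R (.pi U K) (.pi U' K)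
  | piCod (U : Ty C F) {K K' : Kd C F} : KStep R K K' → KStep R (.pi U K) (.pi U K')

/-- `β`-normal terms: no step with the empty set of rules. -/
def BetaNormal {l : Lvl} (t : Term C F l) : Prop :=
  ∀ t' : Term C F l, ¬ Step (fun _ _ _ _ => False) t t'

/-- Rules are of the form `f p₁ … pₙ → r` with `n` the arity of `f`, patterns `pᵢ` and `r`
`β`-normal. -/
def Sig.IsRewriteSystem (S : Sig C F) (R : Rules C F) : Prop :=
  ∀ (l : Lvl) (f : F l) (ps : List (Obj C F)) (r : Term C F l), R f ps r →
    ps.length = S.arity ⟨l, f⟩ ∧ (∀ p ∈ ps, S.IsPattern p) ∧ BetaNormal r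

/-- The symbols that head a rule. -/
def Defined (R : Rules C F) : Set (Sym F) := {f | ∃ ps r, R f.2 ps r}

/-- Confluence of a relation. -/
def IsConfluent {α : Type*} (r : α → α → Prop) : Prop :=
  ∀ a b c, Relation.ReflTransGen r a b → Relation.ReflTransGen r a c →
    ∃ d, Relation.ReflTransGen r b d ∧ Relation.ReflTransGen r c d

/-- Strong normalization of `a`: every reduction sequence from `a` is finite. -/
def Terminates {α : Type*} (r : α → α → Prop) (a : α) : Prop := Acc (fun x y => r y x) a

/-! ### Typing in the `λΠ`-calculus modulo `β` and `R` -/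

/-- Judgments; in a context the most recently bound variable comes first. -/
inductive Judg (C : Type u) (F : Lvl → Type v) : Type (max u v)
  /-- `Γ` is well formed -/
  | ctx (Γ : List (Ty C F))
  /-- `Γ ⊢ K : Kind` -/
  | kind (Γ : List (Ty C F)) (K : Kd C F)
  /-- `Γ ⊢ T : K` -/
  | ty (Γ : List (Ty C F)) (T : Ty C F) (K : Kd C F)
  /-- `Γ ⊢ t : A` -/
  | obj (Γ : List (Ty C F)) (t : Obj C F) (A : Ty C F)

/-- Derivable judgments. -/
inductive Deriv (S : Sig C F) (R : Rules C F) : Judg C F → Prop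
  | ctxNil : Deriv S R (.ctx [])
  | ctxCons {Γ : List (Ty C F)} {A : Ty C F} :
      Deriv S R (.ctx Γ) → Deriv S R (.ty Γ A .type) → Deriv S R (.ctx (A :: Γ))
  | kindType {Γ : List (Ty C F)} : Deriv S R (.ctx Γ) → Deriv S R (.kind Γ .type)
  | kindPi {Γ : List (Ty C F)} {U : Ty C F} {K : Kd C F} :
      Deriv S R (.ty Γ U .type) → Deriv S R (.kind (U :: Γ) K) → Deriv S R (.kind Γ (.pi U K))
  | tyCon {Γ : List (Ty C F)} (D : C) :
      Deriv S R (.ctx Γ) → Deriv S R (.kind [] (S.con D)) → Deriv S R (.ty Γ (.con D) (S.con D))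
  | tyFn {Γ : List (Ty C F)} (f : F .ty) :
      Deriv S R (.ctx Γ) → Deriv S R (.kind [] (S.tyFn f)) →
      Deriv S R (.ty Γ (.fn f) (S.tyFn f))
  | tyPi {Γ : List (Ty C F)} {U T : Ty C F} :
      Deriv S R (.ty Γ U .type) → Deriv S R (.ty (U :: Γ) T .type) →
      Deriv S R (.ty Γ (.pi U T) .type)
  | tyLam {Γ : List (Ty C F)} {U T : Ty C F} {K : Kd C F} :
      Deriv S R (.ty Γ U .type) → Deriv S R (.ty (U :: Γ) T K) →
      Deriv S R (.ty Γ (.lam U T) (.pi U K))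
  | tyApp {Γ : List (Ty C F)} {T U : Ty C F} {K : Kd C F} {u : Obj C F} :
      Deriv S R (.ty Γ T (.pi U K)) → Deriv S R (.obj Γ u U) →
      Deriv S R (.ty Γ (.app T u) (K.inst u))
  | tyConv {Γ : List (Ty C F)} {T : Ty C F} {K K' : Kd C F} :
      Deriv S R (.ty Γ T K) → Deriv S R (.kind Γ K) → Deriv S R (.kind Γ K') →
      Relation.EqvGen (KStep R) K K' → Deriv S R (.ty Γ T K')
  | objVar {Γ : List (Ty C F)} {n : ℕ} {A : Ty C F} :
      Deriv S R (.ctx Γ) → Γ[n]? = some A → Deriv S R (.obj Γ (.var n) (A.shift (n + 1)))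
  | objFn {Γ : List (Ty C F)} (f : F .obj) :
      Deriv S R (.ctx Γ) → Deriv S R (.ty [] (S.objFn f) .type) →
      Deriv S R (.obj Γ (.fn f) (S.objFn f))
  | objLam {Γ : List (Ty C F)} {U B : Ty C F} {t : Obj C F} :
      Deriv S R (.ty Γ U .type) → Deriv S R (.obj (U :: Γ) t B) →
      Deriv S R (.obj Γ (.lam U t) (.pi U B))
  | objApp {Γ : List (Ty C F)} {U B : Ty C F} {t u : Obj C F} :
      Deriv S R (.obj Γ t (.pi U B)) → Deriv S R (.obj Γ u U) →
      Deriv S R (.obj Γ (.app t u) (B.inst u))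
  | objConv {Γ : List (Ty C F)} {t : Obj C F} {A B : Ty C F} :
      Deriv S R (.obj Γ t A) → Deriv S R (.ty Γ A .type) → Deriv S R (.ty Γ B .type) →
      Relation.EqvGen (Step R) A B → Deriv S R (.obj Γ t B)

/-- Reduction preserves typing. -/
def PreservesTyping (S : Sig C F) (R : Rules C F) : Prop :=
  (∀ Γ t t' A, Deriv S R (.obj Γ t A) → Step R t t' → Deriv S R (.obj Γ t' A)) ∧
  (∀ Γ T T' K, Deriv S R (.ty Γ T K) → Step R T T' → Deriv S R (.ty Γ T' K)) ∧
  (∀ Γ K K', Deriv S R (.kind Γ K) → KStep R K K' → Deriv S R (.kind Γ K'))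

/-! ### Formal calls and size-change termination -/

/-- `SubtermAt s k t`: `s` occurs in `t` below exactly `k` binders of `t`. -/
inductive SubtermAt : {l l' : Lvl} → Term C F l → ℕ → Term C F l' → Prop
  | refl {l : Lvl} (t : Term C F l) : SubtermAt t 0 t
  | lamDom {l l' : Lvl} {s : Term C F l} {k : ℕ} {U : Ty C F} (t : Term C F l') :
      SubtermAt s k U → SubtermAt s k (.lam U t)
  | lamBody {l l' : Lvl} {s : Term C F l} {k : ℕ} (U : Ty C F) {t : Term C F l'} :
      SubtermAt s k t → SubtermAt s (k + 1) (.lam U t)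
  | appFun {l l' : Lvl} {s : Term C F l} {k : ℕ} {t : Term C F l'} (u : Obj C F) :
      SubtermAt s k t → SubtermAt s k (.app t u)
  | appArg {l l' : Lvl} {s : Term C F l} {k : ℕ} (t : Term C F l') {u : Obj C F} :
      SubtermAt s k u → SubtermAt s k (.app t u)
  | piDom {l : Lvl} {s : Term C F l} {k : ℕ} {U : Ty C F} (T : Ty C F) :
      SubtermAt s k U → SubtermAt s k (.pi U T)
  | piCod {l : Lvl} {s : Term C F l} {k : ℕ} (U : Ty C F) {T : Ty C F} :
      SubtermAt s k T → SubtermAt s (k + 1) (.pi U T)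

/-- The formal call relation `f ps >_call g ts`, for an occurrence of `g ts` below `k` binders of
the right-hand side: in `ts` the pattern variable `n` is the index `n + k`. -/
def Call (S : Sig C F) (R : Rules C F) (f : Sym F) (ps : List (Obj C F)) (k : ℕ) (g : Sym F)
    (ts : List (Obj C F)) : Prop :=
  ∃ r : Term C F f.1, R f.2 ps r ∧ ts.length = S.arity g ∧ SubtermAt (apps (.fn g.2) ts) k r

/-- The strict constructor subterm relation. -/
def CtorSub (S : Sig C F) : Obj C F → Obj C F → Prop :=
  Relation.TransGen fun t s => ∃ c ts, S.IsCtor c ∧ t ∈ ts ∧ s = apps (.fn c) ts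

/-- Matrices with entries `-1`, `0` and `∞ = ⊤`. -/
abbrev SizeMatrix (m n : ℕ) := Fin m → Fin n → WithTop ℤ

open Classical in
/-- The matrix of the call `f ps >_call g ts` at depth `k`. -/
noncomputable def callMatrix (S : Sig C F) (m n : ℕ) (ps : List (Obj C F)) (k : ℕ)
    (ts : List (Obj C F)) : SizeMatrix m n := fun i j =>
  if ∃ p t, ps[i.1]? = some p ∧ ts[j.1]? = some t ∧ CtorSub S t (p.shift k) then -1
  else if ∃ p t, ps[i.1]? = some p ∧ ts[j.1]? = some t ∧ t = p.shift k then 0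
  else ⊤

/-- Matrix product over the semiring `{-1, 0, ∞}` whose sum is the minimum (`∞`, the absence of
information, being neutral) and whose product is addition truncated at `-1`. -/
def SizeMatrix.comp {m n p : ℕ} (A : SizeMatrix m n) (B : SizeMatrix n p) : SizeMatrix m p :=
  fun i j => Finset.univ.inf fun k => max (-1) (A i k + B k j)

/-- The edges of the transitive closure of the call graph. -/
inductive CallPath (S : Sig C F) (R : Rules C F) :
    (f g : Sym F) → SizeMatrix (S.arity f) (S.arity g) → Prop
  | edge {f g : Sym F} {ps ts : List (Obj C F)} {k : ℕ} : Call S R f ps k g ts →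
      CallPath S R f g (callMatrix S (S.arity f) (S.arity g) ps k ts)
  | comp {f g h : Sym F} {A : SizeMatrix (S.arity f) (S.arity g)}
      {B : SizeMatrix (S.arity g) (S.arity h)} :
      CallPath S R f g A → CallPath S R g h B → CallPath S R f h (A.comp B)

/-- The size-change termination principle. -/
def SizeChangeTerminating (S : Sig C F) (R : Rules C F) : Prop :=
  ∀ (f : Sym F) (M : SizeMatrix (S.arity f) (S.arity f)), CallPath S R f f M → ∃ i, M i i = -1

/-! ### Computability closure -/

/-- `AccTy S T ps x A`: when the patterns `ps` are the first arguments of a symbol of type `T`, the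
variable `x` occurs in `ps` at a position where an object of type `A` is expected. -/
inductive AccTy (S : Sig C F) : Ty C F → List (Obj C F) → ℕ → Ty C F → Prop
  | here {A B : Ty C F} {x : ℕ} {ps : List (Obj C F)} : AccTy S (.pi A B) (.var x :: ps) x A
  | inside {A B T : Ty C F} {x : ℕ} {c : F .obj} {qs ps : List (Obj C F)} :
      S.IsCtor c → qs.length = S.arity ⟨.obj, c⟩ → AccTy S (S.objFn c) qs x T →
      AccTy S (.pi A B) (apps (.fn c) qs :: ps) x T
  | there {A B T : Ty C F} {x : ℕ} {p : Obj C F} {ps : List (Obj C F)} :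
      AccTy S (B.inst p) ps x T → AccTy S (.pi A B) (p :: ps) x T

/-- The same for the arguments of a type-level symbol of kind `K`. -/
inductive AccKd (S : Sig C F) : Kd C F → List (Obj C F) → ℕ → Ty C F → Prop
  | here {A : Ty C F} {K : Kd C F} {x : ℕ} {ps : List (Obj C F)} :
      AccKd S (.pi A K) (.var x :: ps) x A
  | inside {A T : Ty C F} {K : Kd C F} {x : ℕ} {c : F .obj} {qs ps : List (Obj C F)} :
      S.IsCtor c → qs.length = S.arity ⟨.obj, c⟩ → AccTy S (S.objFn c) qs x T →
      AccKd S (.pi A K) (apps (.fn c) qs :: ps) x T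
  | there {A T : Ty C F} {K : Kd C F} {x : ℕ} {p : Obj C F} {ps : List (Obj C F)} :
      AccKd S (K.inst p) ps x T → AccKd S (.pi A K) (p :: ps) x T

/-- The variable `x` of the left-hand side `f ps` has type `A`. -/
def Sig.LhsVar (S : Sig C F) : Sym F → List (Obj C F) → ℕ → Ty C F → Prop
  | ⟨.ty, f⟩, ps, x, A => AccKd S (S.tyFn f) ps x A
  | ⟨.obj, f⟩, ps, x, A => AccTy S (S.objFn f) ps x A

/-- Judgments of the computability closure. The context `Γ` holds the variables bound on the way from
the root of the right-hand side; the variables of the left-hand side come after those of `Γ`. -/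
inductive CJudg (C : Type u) (F : Lvl → Type v) : Type (max u v)
  /-- `t` belongs to the closure with type `A` -/
  | obj (Γ : List (Ty C F)) (t : Obj C F) (A : Ty C F)
  /-- `T` belongs to the closure with kind `K` -/
  | ty (Γ : List (Ty C F)) (T : Ty C F) (K : Kd C F)
  /-- the `us` belong to the closure and are arguments for the type `A`, leaving the type `B` -/
  | tyArgs (Γ : List (Ty C F)) (A : Ty C F) (us : List (Obj C F)) (B : Ty C F)
  /-- the `us` belong to the closure and are arguments for the kind `K`, leaving the kind `K'` -/
  | kdArgs (Γ : List (Ty C F)) (K : Kd C F) (us : List (Obj C F)) (K' : Kd C F)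

/-- The computability closure of the left-hand side `f ps` with respect to the formal call relation.
It consists of the typing rules, except that a function symbol `g` can only be introduced by a call
`f ps >_call g us` whose arguments belong to the closure. Conversion is unrestricted, which only
makes the closure larger than with a premise that the new type is well formed. -/
inductive CC (S : Sig C F) (R : Rules C F) (f : Sym F) (ps : List (Obj C F)) : CJudg C F → Prop
  | lhsVar {Γ : List (Ty C F)} {x : ℕ} {A : Ty C F} : S.LhsVar f ps x A →
      CC S R f ps (.obj Γ (.var (x + Γ.length)) (A.shift Γ.length))
  | boundVar {Γ : List (Ty C F)} {n : ℕ} {A : Ty C F} : Γ[n]? = some A →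
      CC S R f ps (.obj Γ (.var n) (A.shift (n + 1)))
  | objCall {Γ : List (Ty C F)} {g : F .obj} {us : List (Obj C F)} {B : Ty C F} :
      Call S R f ps Γ.length ⟨.obj, g⟩ us → Deriv S R (.ty [] (S.objFn g) .type) →
      CC S R f ps (.tyArgs Γ (S.objFn g) us B) → CC S R f ps (.obj Γ (apps (.fn g) us) B)
  | tyCall {Γ : List (Ty C F)} {g : F .ty} {us : List (Obj C F)} {K : Kd C F} :
      Call S R f ps Γ.length ⟨.ty, g⟩ us → Deriv S R (.kind [] (S.tyFn g)) →
      CC S R f ps (.kdArgs Γ (S.tyFn g) us K) → CC S R f ps (.ty Γ (apps (.fn g) us) K)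
  | tyArgsNil {Γ : List (Ty C F)} {A : Ty C F} : CC S R f ps (.tyArgs Γ A [] A)
  | tyArgsCons {Γ : List (Ty C F)} {A B B' : Ty C F} {u : Obj C F} {us : List (Obj C F)} :
      CC S R f ps (.obj Γ u A) → CC S R f ps (.tyArgs Γ (B.inst u) us B') →
      CC S R f ps (.tyArgs Γ (.pi A B) (u :: us) B')
  | kdArgsNil {Γ : List (Ty C F)} {K : Kd C F} : CC S R f ps (.kdArgs Γ K [] K)
  | kdArgsCons {Γ : List (Ty C F)} {A : Ty C F} {K K' : Kd C F} {u : Obj C F}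
      {us : List (Obj C F)} :
      CC S R f ps (.obj Γ u A) → CC S R f ps (.kdArgs Γ (K.inst u) us K') →
      CC S R f ps (.kdArgs Γ (.pi A K) (u :: us) K')
  | tyCon {Γ : List (Ty C F)} (D : C) :
      Deriv S R (.kind [] (S.con D)) → CC S R f ps (.ty Γ (.con D) (S.con D))
  | tyPi {Γ : List (Ty C F)} {U T : Ty C F} :
      CC S R f ps (.ty Γ U .type) → CC S R f ps (.ty (U :: Γ) T .type) →
      CC S R f ps (.ty Γ (.pi U T) .type)
  | tyLam {Γ : List (Ty C F)} {U T : Ty C F} {K : Kd C F} :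
      CC S R f ps (.ty Γ U .type) → CC S R f ps (.ty (U :: Γ) T K) →
      CC S R f ps (.ty Γ (.lam U T) (.pi U K))
  | tyApp {Γ : List (Ty C F)} {T U : Ty C F} {K : Kd C F} {u : Obj C F} :
      CC S R f ps (.ty Γ T (.pi U K)) → CC S R f ps (.obj Γ u U) →
      CC S R f ps (.ty Γ (.app T u) (K.inst u))
  | tyConv {Γ : List (Ty C F)} {T : Ty C F} {K K' : Kd C F} :
      CC S R f ps (.ty Γ T K) → Relation.EqvGen (KStep R) K K' → CC S R f ps (.ty Γ T K')
  | objLam {Γ : List (Ty C F)} {U B : Ty C F} {t : Obj C F} :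
      CC S R f ps (.ty Γ U .type) → CC S R f ps (.obj (U :: Γ) t B) →
      CC S R f ps (.obj Γ (.lam U t) (.pi U B))
  | objApp {Γ : List (Ty C F)} {U B : Ty C F} {t u : Obj C F} :
      CC S R f ps (.obj Γ t (.pi U B)) → CC S R f ps (.obj Γ u U) →
      CC S R f ps (.obj Γ (.app t u) (B.inst u))
  | objConv {Γ : List (Ty C F)} {t : Obj C F} {A B : Ty C F} :
      CC S R f ps (.obj Γ t A) → Relation.EqvGen (Step R) A B → CC S R f ps (.obj Γ t B)

/-- The result type of a symbol of type `T` applied to the given arguments. -/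
def resultTy : Ty C F → List (Obj C F) → Ty C F
  | T, [] => T
  | .pi _ B, p :: ps => resultTy (B.inst p) ps
  | T, _ :: _ => T

/-- Every right-hand side belongs to the computability closure of its left-hand side, with the type
of that left-hand side (which is `Type` when the head is a type-level symbol). -/
def SatisfiesCC (S : Sig C F) (R : Rules C F) : Prop :=
  (∀ (f : F .obj) ps r, R f ps r → CC S R ⟨.obj, f⟩ ps (.obj [] r (resultTy (S.objFn f) ps))) ∧
  (∀ (f : F .ty) ps r, R f ps r → CC S R ⟨.ty, f⟩ ps (.ty [] r .type))

end LambdaPi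

open LambdaPi

/-!
Types are interpreted by reducibility candidates: a type convertible to a product by the objects
that map the interpretation of its domain to the interpretations of its codomain, any other type by
the strongly normalizing objects. Confluence makes interpretations unique and invariant under
conversion. Computability of an object is then membership in the interpretation of its type, and
typable terms are computable as soon as the calls `g ts` with computable arguments `ts` are.

The type of a call may itself contain calls, so it is not known to be interpretable when the call is
treated. Computability is therefore extended to the types without interpretation, in such a way that
it is still a candidate and still compatible with abstraction, application and conversion. The calls
can then be shown computable before the types of the symbols are: by well-founded induction on the
call relation between instances, since the computability closure reduces the computability of the
right-hand sides to that of the calls they contain.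

The call relation is well founded by size-change termination. The size of a strongly normalizing
object is its rank for the union of reduction and of the passage to an argument of a constructor, so
that an entry `-1` of a call matrix is a decrease and an entry `0` is not an increase. On an
infinite sequence of calls some symbol recurs infinitely often, and Dickson's lemma provides two of
its occurrences between which no argument gets smaller, against the `-1` on the diagonal of the
matrix of the loop between them.
-/

namespace LambdaPi

variable {C : Type u} {F : Lvl → Type v} {S : Sig C F} {R : Rules C F}

/-! ### Substitution, heads and arguments -/

/-- The substitution that sends `0` to `u` and `n + 1` to `σ n`. -/
def scons (u : Obj C F) (σ : ℕ → Obj C F) : ℕ → Obj C F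
  | 0 => u
  | n + 1 => σ n

theorem single_eq_scons (u : Obj C F) : single u = scons u .var := by
  funext n; cases n <;> rfl

theorem liftSub_var_comp (ξ : ℕ → ℕ) :
    liftSub (fun n => (.var (ξ n) : Obj C F)) = fun n => .var (liftRen ξ n) := by
  funext n; cases n <;> rfl

theorem liftSub_var : liftSub (.var : ℕ → Obj C F) = .var := by
  funext n; cases n <;> rfl

theorem liftSub_comp_liftRen (σ : ℕ → Obj C F) (ξ : ℕ → ℕ) :
    (fun n => liftSub σ (liftRen ξ n)) = liftSub (fun n => σ (ξ n)) := by
  funext n; cases n <;> rfl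

theorem Term.rename_eq_subst {l : Lvl} (t : Term C F l) (ξ : ℕ → ℕ) :
    t.rename ξ = t.subst (fun n => .var (ξ n)) := by
  induction t generalizing ξ <;> simp only [rename, subst, liftSub_var_comp, *]

theorem Term.rename_subst {l : Lvl} (t : Term C F l) (ξ : ℕ → ℕ) (σ : ℕ → Obj C F) :
    (t.rename ξ).subst σ = t.subst (fun n => σ (ξ n)) := by
  induction t generalizing ξ σ <;> simp only [rename, subst, liftSub_comp_liftRen, *]

theorem liftSub_rename_liftRen (σ : ℕ → Obj C F) (ξ : ℕ → ℕ) :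
    (fun n => (liftSub σ n).rename (liftRen ξ)) = liftSub (fun n => (σ n).rename ξ) := by
  funext n
  cases n with
  | zero => rfl
  | succ n =>
    simp only [liftSub, Term.shift, Term.rename_eq_subst _ (liftRen ξ), Term.rename_subst,
      Term.rename_eq_subst ((σ n).rename ξ), liftRen]

theorem Term.subst_rename {l : Lvl} (t : Term C F l) (σ : ℕ → Obj C F) (ξ : ℕ → ℕ) :
    (t.subst σ).rename ξ = t.subst (fun n => (σ n).rename ξ) := by
  induction t generalizing ξ σ <;> simp only [rename, subst, liftSub_rename_liftRen, *]

theorem liftSub_subst_liftSub (σ ρ : ℕ → Obj C F) :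
    (fun n => (liftSub σ n).subst (liftSub ρ)) = liftSub (fun n => (σ n).subst ρ) := by
  funext n
  cases n with
  | zero => rfl
  | succ n => simp only [liftSub, Term.shift, Term.rename_subst, Term.subst_rename]

theorem Term.subst_subst {l : Lvl} (t : Term C F l) (σ ρ : ℕ → Obj C F) :
    (t.subst σ).subst ρ = t.subst (fun n => (σ n).subst ρ) := by
  induction t generalizing σ ρ <;> simp only [subst, liftSub_subst_liftSub, *]

theorem Term.subst_var {l : Lvl} (t : Term C F l) : t.subst .var = t := by
  induction t <;> simp only [subst, liftSub_var, *]

theorem Term.shift_subst {l : Lvl} (t : Term C F l) (k : ℕ) (σ : ℕ → Obj C F) :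
    (t.shift k).subst σ = t.subst (fun n => σ (n + k)) := t.rename_subst _ _

theorem Term.shift_zero {l : Lvl} (t : Term C F l) : t.shift 0 = t :=
  (t.rename_eq_subst _).trans t.subst_var

theorem Term.shift_succ_subst_scons {l : Lvl} (t : Term C F l) (k : ℕ) (u : Obj C F)
    (σ : ℕ → Obj C F) : (t.shift (k + 1)).subst (scons u σ) = (t.shift k).subst σ := by
  simp only [shift_subst]; rfl

theorem scons_subst (u : Obj C F) (σ ρ : ℕ → Obj C F) :
    (fun n => (scons u σ n).subst ρ) = scons (u.subst ρ) (fun n => (σ n).subst ρ) := by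
  funext n; cases n <;> rfl

theorem liftSub_subst_single (σ : ℕ → Obj C F) (u : Obj C F) :
    (fun n => (liftSub σ n).subst (single u)) = scons u σ := by
  funext n
  cases n with
  | zero => rfl
  | succ n => rw [liftSub, single_eq_scons, Term.shift_succ_subst_scons, Term.shift_zero,
      Term.subst_var, scons]

theorem liftSub_subst_scons (σ ρ : ℕ → Obj C F) (u : Obj C F) :
    (fun n => (liftSub σ n).subst (scons u ρ)) = scons u (fun n => (σ n).subst ρ) := by
  funext n
  cases n with
  | zero => rfl
  | succ n => rw [liftSub, Term.shift_succ_subst_scons, Term.shift_zero, scons]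

theorem Term.inst_subst {l : Lvl} (t : Term C F l) (u : Obj C F) (σ : ℕ → Obj C F) :
    (t.inst u).subst σ = t.subst (scons (u.subst σ) σ) := by
  simp only [inst, single_eq_scons, subst_subst, scons_subst, subst]

theorem Term.subst_liftSub_inst {l : Lvl} (t : Term C F l) (σ : ℕ → Obj C F) (u : Obj C F) :
    (t.subst (liftSub σ)).inst u = t.subst (scons u σ) := by
  rw [inst, subst_subst, liftSub_subst_single]

theorem Term.inst_subst_comm {l : Lvl} (t : Term C F l) (u : Obj C F) (σ : ℕ → Obj C F) :
    (t.inst u).subst σ = (t.subst (liftSub σ)).inst (u.subst σ) := by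
  rw [inst_subst, subst_liftSub_inst]

theorem apps_append {l : Lvl} (t : Term C F l) (us vs : List (Obj C F)) :
    apps t (us ++ vs) = apps (apps t us) vs := by
  induction us generalizing t with
  | nil => rfl
  | cons u _ ih => exact ih _

theorem apps_concat {l : Lvl} (t : Term C F l) (us : List (Obj C F)) (u : Obj C F) :
    apps t (us ++ [u]) = .app (apps t us) u := apps_append _ _ _

theorem apps_subst {l : Lvl} (t : Term C F l) (us : List (Obj C F)) (σ : ℕ → Obj C F) :
    (apps t us).subst σ = apps (t.subst σ) (us.map (Term.subst σ)) := by
  induction us generalizing t with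
  | nil => rfl
  | cons u _ ih => exact ih _

theorem Term.arity_obj (t : Obj C F) : t.arity = 0 := by
  cases t <;> rfl

theorem Term.arity_subst {l : Lvl} (t : Term C F l) (σ : ℕ → Obj C F) :
    (t.subst σ).arity = t.arity := by
  induction t generalizing σ with
  | var => exact arity_obj _
  | pi U T _ ihT => simp only [subst, arity, ihT]
  | _ => rfl

theorem Kd.arity_subst (K : Kd C F) (σ : ℕ → Obj C F) : (K.subst σ).arity = K.arity := by
  induction K generalizing σ <;> simp only [subst, arity, *]

/-- The head `h` of `t = h u₁ … uₙ`, `h` not being an application. -/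
def Term.head : {l : Lvl} → Term C F l → Term C F l
  | _, .app t _ => t.head
  | _, t => t

/-- The arguments `u₁, …, uₙ` of `t = h u₁ … uₙ`, `h` not being an application. -/
def Term.args : {l : Lvl} → Term C F l → List (Obj C F)
  | _, .app t u => t.args ++ [u]
  | _, _ => []

theorem apps_head_args {l : Lvl} (t : Term C F l) : apps t.head t.args = t := by
  induction t with
  | app t u iht _ => rw [Term.head, Term.args, apps_concat, iht]
  | _ => rfl

theorem head_apps {l : Lvl} (t : Term C F l) (us : List (Obj C F)) :
    (apps t us).head = t.head := by
  induction us generalizing t with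
  | nil => rfl
  | cons u _ ih => exact ih _

theorem args_apps {l : Lvl} (t : Term C F l) (us : List (Obj C F)) :
    (apps t us).args = t.args ++ us := by
  induction us generalizing t with
  | nil => exact (List.append_nil _).symm
  | cons u us ih => rw [apps, ih, Term.args, List.append_assoc, List.singleton_append]

theorem apps_fn_inj {l : Lvl} {f g : F l} {us vs : List (Obj C F)}
    (h : apps (.fn f : Term C F l) us = apps (.fn g) vs) : f = g ∧ us = vs :=
  ⟨by simpa only [head_apps, Term.head, Term.fn.injEq] using congrArg Term.head h,
    by simpa only [args_apps, Term.args, List.nil_append] using congrArg Term.args h⟩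

theorem apps_fn_eq_app {l : Lvl} {f : F l} {us : List (Obj C F)} {t : Term C F l} {u : Obj C F}
    (h : apps (.fn f) us = .app t u) : ∃ vs, us = vs ++ [u] ∧ t = apps (.fn f) vs := by
  refine ⟨t.args, by simpa only [args_apps, Term.args, List.nil_append] using congrArg Term.args h,
    ?_⟩
  have hhead : .fn f = t.head := by simpa only [head_apps, Term.head] using congrArg Term.head h
  rw [hhead, apps_head_args]

/-- The head of `t` is a type-level constant. -/
def Term.ConHeaded : {l : Lvl} → Term C F l → Prop
  | _, .con _ => True
  | _, .app t _ => t.ConHeaded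
  | _, _ => False

theorem conHeaded_apps {l : Lvl} (t : Term C F l) (us : List (Obj C F)) :
    (apps t us).ConHeaded ↔ t.ConHeaded := by
  induction us generalizing t with
  | nil => rfl
  | cons u _ ih => exact ih _

theorem not_conHeaded_apps_fn {l : Lvl} (f : F l) (us : List (Obj C F)) :
    ¬ (apps (.fn f : Term C F l) us).ConHeaded := by
  simp only [conHeaded_apps, Term.ConHeaded, not_false_eq_true]

/-- The free variables of the subject of `J` are declared in the context of `J`, said by means of
substitutions: the subject is fixed by those that fix the variables of the context. -/
def Judg.SubjectScoped : Judg C F → Prop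
  | .ctx _ => True
  | .kind Γ K => ∀ ⦃σ⦄, (∀ m < Γ.length, σ m = .var m) → K.subst σ = K
  | .ty Γ T _ => ∀ ⦃σ⦄, (∀ m < Γ.length, σ m = .var m) → T.subst σ = T
  | .obj Γ t _ => ∀ ⦃σ⦄, (∀ m < Γ.length, σ m = .var m) → t.subst σ = t

theorem liftSub_eq_var_of_lt {n : ℕ} {σ : ℕ → Obj C F} (h : ∀ m < n, σ m = .var m) :
    ∀ m < n + 1, liftSub σ m = .var m
  | 0, _ => rfl
  | m + 1, hm => by rw [liftSub, h m (by omega)]; rfl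

theorem Deriv.subjectScoped {J : Judg C F} (h : Deriv S R J) : J.SubjectScoped := by
  induction h with
  | ctxNil | ctxCons => trivial
  | kindType | tyCon | tyFn | objFn => exact fun σ _ => rfl
  | objVar _ h => exact fun σ hσ => hσ _ (List.getElem?_eq_some_iff.1 h).1
  | kindPi _ _ h₁ h₂ => exact fun σ hσ => congrArg₂ Kd.pi (h₁ hσ) (h₂ (liftSub_eq_var_of_lt hσ))
  | tyPi _ _ h₁ h₂ => exact fun σ hσ => congrArg₂ Term.pi (h₁ hσ) (h₂ (liftSub_eq_var_of_lt hσ))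
  | tyLam _ _ h₁ h₂ | objLam _ _ h₁ h₂ =>
    exact fun σ hσ => congrArg₂ Term.lam (h₁ hσ) (h₂ (liftSub_eq_var_of_lt hσ))
  | tyApp _ _ h₁ h₂ | objApp _ _ h₁ h₂ => exact fun σ hσ => congrArg₂ Term.app (h₁ hσ) (h₂ hσ)
  | tyConv _ _ _ _ h | objConv _ _ _ _ h => exact h

theorem Deriv.ty_subst_eq {T : Ty C F} {K : Kd C F} (h : Deriv S R (.ty [] T K))
    (σ : ℕ → Obj C F) : T.subst σ = T :=
  h.subjectScoped fun _ hm => absurd hm (Nat.not_lt_zero _)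

theorem Deriv.kind_subst_eq {K : Kd C F} (h : Deriv S R (.kind [] K)) (σ : ℕ → Obj C F) :
    K.subst σ = K :=
  h.subjectScoped fun _ hm => absurd hm (Nat.not_lt_zero _)

/-! ### Reduction and conversion -/

/-- Reduction in any number of steps. -/
abbrev Red (R : Rules C F) {l : Lvl} : Term C F l → Term C F l → Prop :=
  Relation.ReflTransGen (Step R)

/-- Convertibility, written `↔*` in the paper. -/
abbrev Conv (R : Rules C F) {l : Lvl} : Term C F l → Term C F l → Prop :=
  Relation.EqvGen (Step R)

/-- Strong normalization of terms. -/
abbrev SN (R : Rules C F) {l : Lvl} (t : Term C F l) : Prop := Terminates (Step R) t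

theorem Step.subst {l : Lvl} {t t' : Term C F l} (h : Step R t t') (σ : ℕ → Obj C F) :
    Step R (t.subst σ) (t'.subst σ) := by
  induction h generalizing σ with
  | beta U t u => rw [Term.inst_subst_comm]; exact .beta _ _ _
  | rule ρ hr =>
    rw [apps_subst, Term.subst_subst, List.map_map]
    simp only [Function.comp_def, Term.subst_subst]
    exact .rule _ hr
  | lamDom t _ ih => exact .lamDom _ (ih σ)
  | lamBody U _ ih => exact .lamBody _ (ih _)
  | appFun u _ ih => exact .appFun _ (ih σ)
  | appArg t _ ih => exact .appArg _ (ih σ)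
  | piDom T _ ih => exact .piDom _ (ih σ)
  | piCod U _ ih => exact .piCod _ (ih _)

theorem Red.subst {l : Lvl} {t t' : Term C F l} (h : Red R t t') (σ : ℕ → Obj C F) :
    Red R (t.subst σ) (t'.subst σ) :=
  h.lift (Term.subst σ) fun _ _ h => h.subst σ

theorem Red.lam {l : Lvl} {U U' : Ty C F} {t t' : Term C F l} (hU : Red R U U')
    (ht : Red R t t') : Red R (.lam U t) (.lam U' t') :=
  (hU.lift (Term.lam · t) fun _ _ => .lamDom t).trans (ht.lift (Term.lam U') fun _ _ => .lamBody U')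

theorem Red.app {l : Lvl} {t t' : Term C F l} {u u' : Obj C F} (ht : Red R t t')
    (hu : Red R u u') : Red R (.app t u) (.app t' u') :=
  (ht.lift (Term.app · u) fun _ _ => .appFun u).trans (hu.lift (Term.app t') fun _ _ => .appArg t')

theorem Red.pi {U U' T T' : Ty C F} (hU : Red R U U') (hT : Red R T T') :
    Red R (.pi U T) (.pi U' T') :=
  (hU.lift (Term.pi · T) fun _ _ => .piDom T).trans (hT.lift (Term.pi U') fun _ _ => .piCod U')

theorem red_liftSub {σ σ' : ℕ → Obj C F} (h : ∀ n, Red R (σ n) (σ' n)) :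
    ∀ n, Red R (liftSub σ n) (liftSub σ' n)
  | 0 => .refl
  | n + 1 => by simpa only [liftSub, Term.shift, Term.rename_eq_subst] using (h n).subst _

theorem red_scons {u u' : Obj C F} (hu : Red R u u') (σ : ℕ → Obj C F) :
    ∀ n, Red R (scons u σ n) (scons u' σ n)
  | 0 => hu
  | _ + 1 => .refl

theorem Term.red_subst {l : Lvl} (t : Term C F l) {σ σ' : ℕ → Obj C F}
    (h : ∀ n, Red R (σ n) (σ' n)) : Red R (t.subst σ) (t.subst σ') := by
  induction t generalizing σ σ' with
  | var n => exact h n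
  | fn | con => exact .refl
  | lam U t ihU iht => exact (ihU h).lam (iht (red_liftSub h))
  | app t u iht ihu => exact (iht h).app (ihu h)
  | pi U T ihU ihT => exact (ihU h).pi (ihT (red_liftSub h))

theorem Term.red_inst {l : Lvl} (t : Term C F l) {u u' : Obj C F} (h : Red R u u') :
    Red R (t.inst u) (t.inst u') := by
  simp only [Term.inst, single_eq_scons]
  exact t.red_subst (red_scons h _)

theorem Red.conv {l : Lvl} {t t' : Term C F l} (h : Red R t t') : Conv R t t' :=
  Relation.EqvGen.reflTransGen_le_eqvGen _ _ _ h

protected theorem Conv.symm {l : Lvl} {t t' : Term C F l} (h : Conv R t t') : Conv R t' t :=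
  Relation.EqvGen.symm _ _ h

protected theorem Conv.trans {l : Lvl} {t t' t'' : Term C F l} (h : Conv R t t')
    (h' : Conv R t' t'') : Conv R t t'' :=
  Relation.EqvGen.trans _ _ _ h h'

theorem Conv.subst {l : Lvl} {t t' : Term C F l} (h : Conv R t t') (σ : ℕ → Obj C F) :
    Conv R (t.subst σ) (t'.subst σ) := by
  induction h with
  | rel _ _ h => exact .rel _ _ (h.subst σ)
  | refl => exact .refl _
  | symm _ _ _ ih => exact ih.symm
  | trans _ _ _ _ _ ih₁ ih₂ => exact ih₁.trans ih₂

theorem IsConfluent.join_of_eqvGen {α : Type*} {r : α → α → Prop} (hr : IsConfluent r) {a b : α}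
    (h : Relation.EqvGen r a b) : Relation.Join (Relation.ReflTransGen r) a b :=
  (Relation.equivalence_join hr).eqvGen_iff.1
    (h.mono fun _ b h => ⟨b, .single h, .refl⟩)

theorem not_step_var {n : ℕ} {s : Obj C F} (h : Step R (.var n) s) : False := by
  generalize hx : Term.var n = x at h
  cases h with
  | rule => simpa [head_apps, Term.head] using congrArg Term.head hx
  | _ => cases hx

theorem not_step_con {D : C} {s : Ty C F} (h : Step R (.con D) s) : False := by
  generalize hx : Term.con D = x at h
  cases h with
  | rule => simpa [head_apps, Term.head] using congrArg Term.head hx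
  | _ => cases hx

theorem step_lam_iff {l : Lvl} {U : Ty C F} {t s : Term C F l} :
    Step R (.lam U t) s ↔
      (∃ U', Step R U U' ∧ s = .lam U' t) ∨ ∃ t', Step R t t' ∧ s = .lam U t' := by
  refine ⟨fun h => ?_, ?_⟩
  · generalize hx : Term.lam U t = x at h
    cases h with
    | rule => simpa [head_apps, Term.head] using congrArg Term.head hx
    | lamDom _ h => cases hx; exact .inl ⟨_, h, rfl⟩
    | lamBody _ h => cases hx; exact .inr ⟨_, h, rfl⟩
    | _ => cases hx
  · rintro (⟨U', h, rfl⟩ | ⟨t', h, rfl⟩)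
    exacts [.lamDom _ h, .lamBody _ h]

theorem step_pi_iff {U T s : Ty C F} :
    Step R (.pi U T) s ↔
      (∃ U', Step R U U' ∧ s = .pi U' T) ∨ ∃ T', Step R T T' ∧ s = .pi U T' := by
  refine ⟨fun h => ?_, ?_⟩
  · generalize hx : Term.pi U T = x at h
    cases h with
    | rule => simpa [head_apps, Term.head] using congrArg Term.head hx
    | piDom _ h => cases hx; exact .inl ⟨_, h, rfl⟩
    | piCod _ h => cases hx; exact .inr ⟨_, h, rfl⟩
    | _ => cases hx
  · rintro (⟨U', h, rfl⟩ | ⟨T', h, rfl⟩)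
    exacts [.piDom _ h, .piCod _ h]

theorem Step.app_inv {l : Lvl} {t : Term C F l} {u : Obj C F} {s : Term C F l}
    (h : Step R (.app t u) s) :
    (∃ U b, t = .lam U b ∧ s = b.inst u) ∨
    (∃ (f : F l) (ps : List (Obj C F)) (r : Term C F l) (σ : ℕ → Obj C F),
      R f ps r ∧ .app t u = apps (.fn f) (ps.map (Term.subst σ)) ∧ s = r.subst σ) ∨
    (∃ t', Step R t t' ∧ s = .app t' u) ∨ ∃ u', Step R u u' ∧ s = .app t u' := by
  generalize hx : Term.app t u = x at h
  cases h with
  | beta => cases hx; exact .inl ⟨_, _, rfl, rfl⟩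
  | rule σ hr => exact .inr (.inl ⟨_, _, _, σ, hr, rfl, rfl⟩)
  | appFun _ h => cases hx; exact .inr (.inr (.inl ⟨_, h, rfl⟩))
  | appArg _ h => cases hx; exact .inr (.inr (.inr ⟨_, h, rfl⟩))
  | _ => cases hx

theorem Red.lam_inv {l : Lvl} {U : Ty C F} {t s : Term C F l} (h : Red R (.lam U t) s) :
    ∃ U' t', s = .lam U' t' ∧ Red R U U' ∧ Red R t t' := by
  induction h with
  | refl => exact ⟨U, t, rfl, .refl, .refl⟩
  | tail _ h ih =>
    obtain ⟨U', t', rfl, hU, ht⟩ := ih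
    rcases step_lam_iff.1 h with ⟨_, h', rfl⟩ | ⟨_, h', rfl⟩
    · exact ⟨_, _, rfl, hU.tail h', ht⟩
    · exact ⟨_, _, rfl, hU, ht.tail h'⟩

theorem Red.pi_inv {U T s : Ty C F} (h : Red R (.pi U T) s) :
    ∃ U' T', s = .pi U' T' ∧ Red R U U' ∧ Red R T T' := by
  induction h with
  | refl => exact ⟨U, T, rfl, .refl, .refl⟩
  | tail _ h ih =>
    obtain ⟨U', t', rfl, hU, ht⟩ := ih
    rcases step_pi_iff.1 h with ⟨_, h', rfl⟩ | ⟨_, h', rfl⟩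
    · exact ⟨_, _, rfl, hU.tail h', ht⟩
    · exact ⟨_, _, rfl, hU, ht.tail h'⟩

theorem Term.ConHeaded.step {l : Lvl} {t s : Term C F l} (ht : t.ConHeaded) (h : Step R t s) :
    s.ConHeaded := by
  induction h with
  | beta | lamDom | lamBody | piDom | piCod => exact ht.elim
  | rule => exact (not_conHeaded_apps_fn _ _ ht).elim
  | appFun u _ ih => exact ih ht
  | appArg => exact ht

theorem Term.ConHeaded.red {l : Lvl} {t s : Term C F l} (ht : t.ConHeaded) (h : Red R t s) :
    s.ConHeaded := by
  induction h with
  | refl => exact ht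
  | tail _ h ih => exact ih.step h

/-- Confluence of the reduction of types. -/
abbrev ConfluentOnTypes (R : Rules C F) : Prop := IsConfluent (Step R (l := .ty))

theorem Conv.pi_inj (hconf : ConfluentOnTypes R) {U V U' V' : Ty C F}
    (h : Conv R (.pi U V) (.pi U' V')) : Conv R U U' ∧ Conv R V V' := by
  obtain ⟨s, h₁, h₂⟩ := hconf.join_of_eqvGen h
  obtain ⟨U₁, V₁, rfl, hU, hV⟩ := Red.pi_inv h₁
  obtain ⟨U₂, V₂, e, hU', hV'⟩ := Red.pi_inv h₂
  cases e
  exact ⟨hU.conv.trans hU'.conv.symm, hV.conv.trans hV'.conv.symm⟩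

theorem Term.ConHeaded.not_conv_pi (hconf : ConfluentOnTypes R) {T U V : Ty C F}
    (hT : T.ConHeaded) : ¬ Conv R T (.pi U V) := by
  intro h
  obtain ⟨s, h₁, h₂⟩ := hconf.join_of_eqvGen h
  obtain ⟨U₁, V₁, rfl, _, _⟩ := Red.pi_inv h₂
  exact hT.red h₁

/-! ### Strong normalization -/

theorem Terminates.red {α : Type*} {r : α → α → Prop} {a b : α} (ha : Terminates r a)
    (h : Relation.ReflTransGen r a b) : Terminates r b := by
  induction h with
  | refl => exact ha
  | tail _ h ih => exact ih.inv h

theorem Terminates.of_map {α β : Type*} {r : α → α → Prop} {s : β → β → Prop} (φ : α → β)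
    (hφ : ∀ a a', r a a' → s (φ a) (φ a')) {a : α} (h : Terminates s (φ a)) : Terminates r a :=
  Subrelation.accessible (hφ _ _) (InvImage.accessible φ h)

theorem Terminates.map₂ {α β γ : Type*} {r : α → α → Prop} {s : β → β → Prop}
    {q : γ → γ → Prop} {φ : α → β → γ} {a : α} {b : β} (ha : Terminates r a)
    (hb : Terminates s b)
    (hφ : ∀ ⦃a' b' c⦄, Relation.ReflTransGen r a a' → q (φ a' b') c →
      (∃ a'', r a' a'' ∧ c = φ a'' b') ∨ ∃ b'', s b' b'' ∧ c = φ a' b'') :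
    Terminates q (φ a b) := by
  induction ha generalizing b with
  | intro a _ iha =>
    induction hb with
    | intro b hb ihb =>
      refine ⟨_, fun c hc => ?_⟩
      rcases hφ .refl hc with ⟨a', h, rfl⟩ | ⟨b', h, rfl⟩
      · exact iha a' h ⟨b, hb⟩ fun _ _ _ h' => hφ (.head h h')
      · exact ihb b' h

theorem SN.of_subst {l : Lvl} {t : Term C F l} {σ : ℕ → Obj C F} (h : SN R (t.subst σ)) :
    SN R t := h.of_map (Term.subst σ) fun _ _ h => h.subst σ

theorem SN.of_app_left {l : Lvl} {t : Term C F l} {u : Obj C F} (h : SN R (.app t u)) :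
    SN R t := h.of_map (Term.app · u) fun _ _ => .appFun u

theorem SN.of_app_right {l : Lvl} {t : Term C F l} {u : Obj C F} (h : SN R (.app t u)) :
    SN R u := h.of_map (Term.app t) fun _ _ => .appArg t

theorem SN.of_apps {l : Lvl} {t : Term C F l} {us : List (Obj C F)} (h : SN R (apps t us)) :
    SN R t ∧ ∀ u ∈ us, SN R u := by
  induction us generalizing t with
  | nil => exact ⟨h, fun _ h => absurd h List.not_mem_nil⟩
  | cons u us ih =>
    obtain ⟨htu, hus⟩ := ih h
    exact ⟨htu.of_app_left, List.forall_mem_cons.2 ⟨htu.of_app_right, hus⟩⟩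

theorem SN.con (D : C) : SN R (.con D : Ty C F) := ⟨_, fun _ h => (not_step_con h).elim⟩

theorem SN.lam {l : Lvl} {U : Ty C F} {t : Term C F l} (hU : SN R U) (ht : SN R t) :
    SN R (.lam U t) :=
  hU.map₂ ht fun _ _ _ _ => step_lam_iff.1

theorem SN.pi {U T : Ty C F} (hU : SN R U) (hT : SN R T) : SN R (.pi U T) :=
  hU.map₂ hT fun _ _ _ _ => step_pi_iff.1

theorem SN.app_of_conHeaded {l : Lvl} {t : Term C F l} {u : Obj C F} (hc : t.ConHeaded)
    (ht : SN R t) (hu : SN R u) : SN R (.app t u) := by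
  refine ht.map₂ hu fun t' u' s htt' hs => ?_
  have hc' : t'.ConHeaded := hc.red htt'
  rcases hs.app_inv with ⟨_, _, rfl, _⟩ | ⟨f, ps, r, σ, _, e, _⟩ | h | h
  · exact hc'.elim
  · exact (not_conHeaded_apps_fn f (ps.map (Term.subst σ)) (e ▸ hc')).elim
  · exact .inl h
  · exact .inr h

/-- One step in one element of a list. -/
inductive ListStep {α : Type*} (r : α → α → Prop) : List α → List α → Prop
  | head {a a' : α} (as : List α) : r a a' → ListStep r (a :: as) (a' :: as)
  | tail (a : α) {as as' : List α} : ListStep r as as' → ListStep r (a :: as) (a :: as')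

theorem ListStep.forall₂ {α : Type*} {r : α → α → Prop} {as as' : List α}
    (h : ListStep r as as') : List.Forall₂ (Relation.ReflTransGen r) as as' := by
  induction h with
  | head as h => exact .cons (.single h) (List.forall₂_refl as)
  | tail a _ ih => exact .cons .refl ih

theorem ListStep.length_eq {α : Type*} {r : α → α → Prop} {as as' : List α}
    (h : ListStep r as as') : as.length = as'.length := h.forall₂.length_eq

theorem ListStep.append_left {α : Type*} {r : α → α → Prop} {as as' : List α}
    (h : ListStep r as as') : ∀ bs, ListStep r (bs ++ as) (bs ++ as')
  | [] => h
  | b :: bs => .tail b (h.append_left bs)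

theorem ListStep.append_right {α : Type*} {r : α → α → Prop} {as as' : List α}
    (h : ListStep r as as') (bs : List α) : ListStep r (as ++ bs) (as' ++ bs) := by
  induction h with
  | head as h => exact .head _ h
  | tail a _ ih => exact .tail _ ih

theorem terminates_listStep {α : Type*} {r : α → α → Prop} {as : List α}
    (h : ∀ a ∈ as, Terminates r a) : Terminates (ListStep r) as := by
  induction as with
  | nil => exact ⟨_, fun _ h => nomatch h⟩
  | cons a as ih =>
    obtain ⟨ha, has⟩ := List.forall_mem_cons.1 h
    refine ha.map₂ (ih has) fun a as s _ hs => ?_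
    cases hs with
    | head _ h => exact .inl ⟨_, h, rfl⟩
    | tail _ h => exact .inr ⟨_, h, rfl⟩

theorem Step.apps_left {l : Lvl} {t t' : Term C F l} (h : Step R t t') (us : List (Obj C F)) :
    Step R (apps t us) (apps t' us) := by
  induction us generalizing t t' with
  | nil => exact h
  | cons u _ ih => exact ih (.appFun u h)

theorem ListStep.step_apps {l : Lvl} {us us' : List (Obj C F)} (h : ListStep (Step R) us us')
    (t : Term C F l) : Step R (apps t us) (apps t us') := by
  induction h generalizing t with
  | head us h => exact (Step.appArg t h).apps_left us
  | tail u _ ih => exact ih _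

/-- The left-hand sides of the rules are applied to as many arguments as the arity of their head. -/
def Sig.FullyApplied (S : Sig C F) (R : Rules C F) : Prop :=
  ∀ ⦃l : Lvl⦄ ⦃f : F l⦄ ⦃ps : List (Obj C F)⦄ ⦃r : Term C F l⦄, R f ps r →
    ps.length = S.arity ⟨l, f⟩

theorem Step.apps_fn_inv (hR : S.FullyApplied R) {l : Lvl} {f : F l} {us : List (Obj C F)}
    {s : Term C F l} (hlen : us.length ≤ S.arity ⟨l, f⟩) (h : Step R (apps (.fn f) us) s) :
    (∃ ps r σ, R f ps r ∧ us = ps.map (Term.subst σ) ∧ s = r.subst σ) ∨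
      ∃ us', ListStep (Step R) us us' ∧ s = apps (.fn f) us' := by
  induction us using List.reverseRecOn generalizing s with
  | nil =>
    generalize hx : apps (.fn f : Term C F l) [] = x at h
    cases h with
    | rule σ hr =>
      obtain ⟨rfl, e⟩ := apps_fn_inj hx
      exact .inl ⟨_, _, σ, hr, e, rfl⟩
    | _ => cases hx
  | append_singleton us u ih =>
    rw [List.length_append, List.length_singleton] at hlen
    rw [apps_concat] at h
    rcases h.app_inv with ⟨U, b, e, _⟩ | ⟨g, ps, r, σ, hr, e, rfl⟩ | ⟨t', h', rfl⟩ | ⟨u', h', rfl⟩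
    · simpa [head_apps, Term.head] using congrArg Term.head e
    · obtain ⟨rfl, e'⟩ := apps_fn_inj ((apps_concat _ _ _).trans e)
      exact .inl ⟨_, _, σ, hr, e', rfl⟩
    · rcases ih (by omega) h' with ⟨ps, r, σ, hr, rfl, rfl⟩ | ⟨us', hs, rfl⟩
      · rw [List.length_map, hR hr] at hlen
        omega
      · exact .inr ⟨us' ++ [u], hs.append_right _, (apps_concat _ _ _).symm⟩
    · exact .inr ⟨us ++ [u'], (ListStep.head _ h').append_left _, (apps_concat _ _ _).symm⟩

/-! ### The size of a strongly normalizing object -/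

/-- `t` is an argument of the constructor term `s`. The transitive closure is `CtorSub S`. -/
def CtorArg (S : Sig C F) (t s : Obj C F) : Prop :=
  ∃ c ts, S.IsCtor c ∧ t ∈ ts ∧ s = apps (.fn c) ts

theorem sizeOf_lt_sizeOf_apps {l : Lvl} {t : Term C F l} {us : List (Obj C F)} {u : Obj C F}
    (hu : u ∈ us) : sizeOf u < sizeOf (apps t us) := by
  induction us using List.reverseRecOn with
  | nil => exact absurd hu List.not_mem_nil
  | append_singleton us v ih =>
    rw [apps_concat, Term.app.sizeOf_spec]
    rcases List.mem_append.1 hu with hu | hu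
    · have := ih hu
      omega
    · rw [List.mem_singleton.1 hu]
      omega

theorem wellFounded_ctorArg : WellFounded (CtorArg S) := by
  refine Subrelation.wf (fun {t s} h => ?_) (measure (sizeOf : Obj C F → ℕ)).wf
  obtain ⟨c, ts, _, hmem, rfl⟩ := h
  exact sizeOf_lt_sizeOf_apps hmem

theorem CtorArg.subst {t s : Obj C F} (h : CtorArg S t s) (σ : ℕ → Obj C F) :
    CtorArg S (t.subst σ) (s.subst σ) := by
  obtain ⟨c, ts, hc, hmem, rfl⟩ := h
  exact ⟨c, ts.map (Term.subst σ), hc, List.mem_map_of_mem hmem, apps_subst _ _ _⟩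

theorem CtorArg.sn {t s : Obj C F} (h : CtorArg S t s) (hs : SN R s) : SN R t := by
  obtain ⟨c, ts, _, hmem, rfl⟩ := h
  exact hs.of_apps.2 t hmem

theorem CtorArg.step {t t' s : Obj C F} (h : CtorArg S t s) (ht : Step R t t') :
    ∃ s', Step R s s' ∧ CtorArg S t' s' := by
  obtain ⟨c, ts, hc, hmem, rfl⟩ := h
  obtain ⟨pre, post, rfl⟩ := List.append_of_mem hmem
  exact ⟨_, ((ListStep.head post ht).append_left pre).step_apps _, c, _, hc, by simp, rfl⟩

theorem CtorSub.subst {t s : Obj C F} (h : CtorSub S t s) (σ : ℕ → Obj C F) :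
    CtorSub S (t.subst σ) (s.subst σ) :=
  h.lift (Term.subst σ) fun _ _ h => CtorArg.subst h σ

theorem Terminates.acc_or {α : Type*} {r q : α → α → Prop} (hq : WellFounded q)
    (hqr : ∀ ⦃t t' s⦄, q t s → r t t' → ∃ s', r s s' ∧ q t' s') {a : α} (ha : Terminates r a) :
    Acc (fun t s => r s t ∨ q t s) a := by
  suffices H : ∀ b, Relation.ReflTransGen q b a → Acc (fun t s => r s t ∨ q t s) b from H a .refl
  induction ha with
  | intro a _ iha =>
    have lift_step : ∀ ⦃b⦄, Relation.ReflTransGen q b a → ∀ ⦃b'⦄, r b b' →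
        ∃ a', r a a' ∧ Relation.ReflTransGen q b' a' := by
      intro b hb
      induction hb using Relation.ReflTransGen.head_induction_on with
      | refl => exact fun b' h => ⟨b', h, .refl⟩
      | head h _ ih =>
        intro b' hb'
        obtain ⟨c', hc', hbc'⟩ := hqr h hb'
        obtain ⟨a', ha', hca'⟩ := ih hc'
        exact ⟨a', ha', .head hbc' hca'⟩
    intro b
    induction b using hq.induction with
    | h b ihb =>
      refine fun hb => ⟨_, fun t ht => ht.elim (fun hbt => ?_) fun htb => ihb t htb (.head htb hb)⟩
      obtain ⟨a', ha', hta'⟩ := lift_step hb hbt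
      exact iha a' ha' t hta'

/-- `t` is a reduct or a constructor argument of the strongly normalizing object `s`. -/
def SizeStep (S : Sig C F) (R : Rules C F) (t s : Obj C F) : Prop :=
  SN R s ∧ (Step R s t ∨ CtorArg S t s)

instance : IsWellFounded (Obj C F) (SizeStep S R) := by
  refine ⟨⟨fun s => ⟨s, fun t hts => ?_⟩⟩⟩
  have hs := hts.1.acc_or (wellFounded_ctorArg (S := S)) fun _ _ _ h => h.step
  exact Subrelation.accessible (fun h => h.2) (hs.inv hts.2)

/-- The size of a strongly normalizing object, which decreases along reductions and when passing to
an argument of a constructor. -/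
noncomputable def size (S : Sig C F) (R : Rules C F) : Obj C F → Ordinal :=
  IsWellFounded.rank (SizeStep S R)

theorem SizeStep.size_lt {t s : Obj C F} (h : SizeStep S R t s) : size S R t < size S R s :=
  IsWellFounded.rank_lt_of_rel h

theorem Red.size_le {s t : Obj C F} (h : Red R s t) (hs : SN R s) : size S R t ≤ size S R s := by
  induction h with
  | refl => exact le_rfl
  | tail h h' ih => exact (SizeStep.size_lt ⟨hs.red h, .inl h'⟩).le.trans ih

theorem CtorSub.size_lt {t s : Obj C F} (h : CtorSub S t s) (hs : SN R s) :
    size S R t < size S R s := by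
  induction h with
  | single h => exact SizeStep.size_lt ⟨hs, .inr h⟩
  | tail _ h ih => exact (ih (CtorArg.sn h hs)).trans (SizeStep.size_lt ⟨hs, .inr h⟩)

/-! ### Size-change termination -/

/-- What the entry `a` of a size-change matrix says of a size `x` of the caller and a size `y` of
the callee. -/
def EntryBound {α : Type*} [Preorder α] (a : WithTop ℤ) (x y : α) : Prop :=
  a = -1 ∧ y < x ∨ a = 0 ∧ y ≤ x ∨ a = ⊤

theorem EntryBound.comp {α : Type*} [Preorder α] {a b : WithTop ℤ} {x y z : α}
    (ha : EntryBound a x y) (hb : EntryBound b y z) : EntryBound (max (-1) (a + b)) x z := by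
  rcases ha with ⟨rfl, hxy⟩ | ⟨rfl, hxy⟩ | rfl
  · rcases hb with ⟨rfl, hyz⟩ | ⟨rfl, hyz⟩ | rfl
    · exact .inl ⟨by decide, hyz.trans hxy⟩
    · exact .inl ⟨by decide, hyz.trans_lt hxy⟩
    · exact .inr (.inr (by simp))
  · rcases hb with ⟨rfl, hyz⟩ | ⟨rfl, hyz⟩ | rfl
    · exact .inl ⟨by decide, hyz.trans_le hxy⟩
    · exact .inr (.inl ⟨by decide, hyz.trans hxy⟩)
    · exact .inr (.inr (by simp))
  · exact .inr (.inr (by simp))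

/-- The matrix `A` is correct for the argument sizes `x` of the caller and `y` of the callee. Sizes
are indexed by all natural numbers, only those below the arities being relevant. -/
def SizeMatrix.Bounds {α : Type*} [Preorder α] {m n : ℕ} (A : SizeMatrix m n) (x y : ℕ → α) :
    Prop :=
  ∀ i j, EntryBound (A i j) (x i) (y j)

theorem SizeMatrix.Bounds.comp {α : Type*} [Preorder α] {m n p : ℕ} {A : SizeMatrix m n}
    {B : SizeMatrix n p} {x y z : ℕ → α} (hA : A.Bounds x y) (hB : B.Bounds y z) :
    (A.comp B).Bounds x z := by
  intro i j
  rcases (Finset.univ : Finset (Fin n)).eq_empty_or_nonempty with he | hne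
  · exact .inr (.inr (by rw [SizeMatrix.comp, he, Finset.inf_empty]))
  · obtain ⟨k, _, hk⟩ := Finset.exists_mem_eq_inf _ hne fun k => max (-1) (A i k + B k j)
    rw [SizeMatrix.comp, hk]
    exact (hA i k).comp (hB k j)

/-- A path of calls leads from the first symbol to the second, and its matrix is correct for the
given argument sizes. -/
def SizeDescent {α : Type*} [Preorder α] (S : Sig C F) (R : Rules C F) (p q : Sym F × (ℕ → α)) :
    Prop :=
  ∃ A, CallPath S R p.1 q.1 A ∧ A.Bounds p.2 q.2

theorem CallPath.mem_defined {f g : Sym F} {A : SizeMatrix (S.arity f) (S.arity g)}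
    (h : CallPath S R f g A) : f ∈ Defined R := by
  induction h with
  | edge h => obtain ⟨r, hr, _⟩ := h; exact ⟨_, r, hr⟩
  | comp _ _ ih _ => exact ih

section SizeDescent

variable {α : Type*} [Preorder α]

theorem SizeDescent.trans {p q s : Sym F × (ℕ → α)} (hpq : SizeDescent S R p q)
    (hqs : SizeDescent S R q s) : SizeDescent S R p s := by
  obtain ⟨A, hA, hxy⟩ := hpq
  obtain ⟨B, hB, hyz⟩ := hqs
  exact ⟨A.comp B, hA.comp hB, hxy.comp hyz⟩

theorem SizeChangeTerminating.exists_lt (hSCT : SizeChangeTerminating S R)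
    {p q : Sym F × (ℕ → α)} (h : SizeDescent S R p q) (hpq : p.1 = q.1) :
    ∃ i < S.arity p.1, q.2 i < p.2 i := by
  obtain ⟨f, x⟩ := p
  obtain ⟨g, y⟩ := q
  obtain rfl : f = g := hpq
  obtain ⟨A, hA, hxy⟩ := h
  obtain ⟨i, hi⟩ := hSCT f A hA
  rcases hxy i i with ⟨-, h⟩ | ⟨h, -⟩ | h
  · exact ⟨i, i.2, h⟩
  · exact absurd (hi.symm.trans h) (by decide)
  · exact absurd (hi.symm.trans h) (by decide)

/-- In an infinite sequence of calls some symbol recurs infinitely often, and Dickson's lemma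
provides two of its occurrences between which no argument size decreases. -/
theorem SizeChangeTerminating.wellFounded [WellQuasiOrderedLE α]
    (hSCT : SizeChangeTerminating S R) (hfin : (Defined R).Finite) :
    WellFounded fun q p : Sym F × (ℕ → α) => SizeDescent S R p q := by
  refine wellFounded_iff_isEmpty_descending_chain.2 ⟨fun ⟨c, hc⟩ => ?_⟩
  have hdescent : ∀ ⦃m n⦄, m < n → SizeDescent S R (c m) (c n) := fun m n hmn =>
    have : IsTrans _ (SizeDescent S R (α := α)) := ⟨fun _ _ _ => SizeDescent.trans⟩
    Nat.rel_of_forall_rel_succ_of_lt (SizeDescent S R) hc hmn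
  have hdefined : ∀ n, (c n).1 ∈ Defined R := fun n => (hc n).choose_spec.1.mem_defined
  obtain ⟨g, hg⟩ := (hfin.partiallyWellOrderedOn (r := Eq)).exists_monotone_subseq hdefined
  obtain ⟨m, n, hmn, hle⟩ := wellQuasiOrdered_le
    fun (n : ℕ) (i : Fin (S.arity (c (g 0)).1)) => (c (g n)).2 i
  obtain ⟨i, hi, hlt⟩ := hSCT.exists_lt (hdescent (g.strictMono hmn)) (hg _ _ hmn.le)
  rw [← hg 0 m (Nat.zero_le m)] at hi
  exact (hle ⟨i, hi⟩).not_gt hlt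

end SizeDescent

/-! ### Calls between instances -/

/-- The right-hand side of a rule `f ps → r`, instantiated by `σ`, contains the call `g vs`. The
instantiation `ρ` of the call extends `σ` to the variables bound above it. -/
def CallInst (S : Sig C F) (R : Rules C F) (f : Sym F) (ps : List (Obj C F)) (σ : ℕ → Obj C F)
    (g : Sym F) (vs : List (Obj C F)) : Prop :=
  ∃ k us ρ, Call S R f ps k g us ∧ (∀ n, ρ (n + k) = σ n) ∧ vs = us.map (Term.subst ρ)

/-- `y = (g, vs)` is called by `x = (f, ts)`: the `ts` are strongly normalizing and reduce to an
instance of the patterns of a rule of `f` whose right-hand side contains the call `g vs`. -/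
def CallRel (S : Sig C F) (R : Rules C F) (y x : Sym F × List (Obj C F)) : Prop :=
  (∀ t ∈ x.2, SN R t) ∧ ∃ ps σ, List.Forall₂ (Red R) x.2 (ps.map (Term.subst σ)) ∧
    CallInst S R x.1 ps σ y.1 y.2

/-- The sequence of the sizes of the objects of a list, continued by a dummy value. -/
noncomputable def argSizes (S : Sig C F) (R : Rules C F) (us : List (Obj C F)) (i : ℕ) : Ordinal :=
  size S R (us.getD i (.var 0))

theorem argSizes_eq {us : List (Obj C F)} {i : ℕ} {u : Obj C F} (h : us[i]? = some u) :
    argSizes S R us i = size S R u := by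
  rw [argSizes, List.getD_eq_getElem?_getD, h, Option.getD_some]

theorem exists_getElem?_of_forall₂ {α β : Type*} {r : α → β → Prop} {as : List α} {bs : List β}
    (h : List.Forall₂ r as bs) {i : ℕ} {b : β} (hb : bs[i]? = some b) :
    ∃ a, as[i]? = some a ∧ r a b := by
  obtain ⟨hi, rfl⟩ := List.getElem?_eq_some_iff.1 hb
  exact ⟨_, List.getElem?_eq_getElem (h.length_eq.symm ▸ hi), h.get _ hi⟩

theorem CallRel.sizeDescent {x y : Sym F × List (Obj C F)} (h : CallRel S R y x) :
    SizeDescent S R (x.1, argSizes S R x.2) (y.1, argSizes S R y.2) := by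
  obtain ⟨f, ts⟩ := x
  obtain ⟨g, vs⟩ := y
  obtain ⟨hsn, ps, σ, hred, k, us, ρ, hcall, hρ, rfl⟩ := h
  refine ⟨_, .edge hcall, fun i j => ?_⟩
  have hpattern : ∀ p, ps[i.1]? = some p → SN R ((p.shift k).subst ρ) ∧
      size S R ((p.shift k).subst ρ) ≤ argSizes S R ts i := by
    intro p hp
    obtain ⟨t, ht, htp⟩ := exists_getElem?_of_forall₂ hred
      (b := p.subst σ) (by rw [List.getElem?_map, hp, Option.map_some])
    have htsn : SN R t := hsn t (List.mem_of_getElem? ht)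
    simp only [Term.shift_subst, hρ, argSizes_eq ht]
    exact ⟨htsn.red htp, htp.size_le htsn⟩
  have hcallee : ∀ u, us[j.1]? = some u →
      argSizes S R (us.map (Term.subst ρ)) j = size S R (u.subst ρ) := fun u hu =>
    argSizes_eq (by rw [List.getElem?_map, hu, Option.map_some])
  unfold callMatrix
  split_ifs with hsub heq
  · obtain ⟨p, u, hp, hu, hup⟩ := hsub
    refine .inl ⟨rfl, (hcallee u hu).trans_lt ?_⟩
    exact ((hup.subst ρ).size_lt (hpattern p hp).1).trans_le (hpattern p hp).2
  · obtain ⟨p, u, hp, hu, rfl⟩ := heq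
    exact .inr (.inl ⟨rfl, (hcallee _ hu).trans_le (hpattern p hp).2⟩)
  · exact .inr (.inr rfl)

theorem SizeChangeTerminating.wellFounded_callRel (hSCT : SizeChangeTerminating S R)
    (hfin : (Defined R).Finite) : WellFounded (CallRel S R) :=
  Subrelation.wf CallRel.sizeDescent
    (InvImage.wf (fun x : Sym F × List (Obj C F) => (x.1, argSizes S R x.2))
      (hSCT.wellFounded hfin))

/-! ### Reducibility candidates -/

/-- Application of a function symbol to fewer arguments than its arity. -/
def PartialApp (S : Sig C F) {l : Lvl} (t : Term C F l) : Prop :=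
  ∃ (f : F l) (us : List (Obj C F)), us.length < S.arity ⟨l, f⟩ ∧ t = apps (.fn f) us

/-- Abstractions and products. -/
def Term.IsBinder : {l : Lvl} → Term C F l → Prop
  | _, .lam _ _ => True
  | _, .pi _ _ => True
  | _, _ => False

/-- Terms whose application to an argument is not a redex. Products are excluded as well, so that a
neutral normal type is not convertible to a product. -/
def Neutral (S : Sig C F) {l : Lvl} (t : Term C F l) : Prop :=
  ¬ t.IsBinder ∧ ¬ PartialApp S t

theorem PartialApp.head_eq_fn {l : Lvl} {t : Term C F l} (h : PartialApp S t) :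
    ∃ f, t.head = .fn f := by
  obtain ⟨f, us, _, rfl⟩ := h
  exact ⟨f, head_apps _ _⟩

theorem not_partialApp_lam {l : Lvl} (U : Ty C F) (t : Term C F l) :
    ¬ PartialApp S (.lam U t) :=
  fun h => nomatch h.head_eq_fn

theorem neutral_var (n : ℕ) : Neutral S (.var n : Obj C F) :=
  ⟨id, fun h => nomatch h.head_eq_fn⟩

theorem neutral_app {l : Lvl} {t : Term C F l} (ht : ¬ PartialApp S t) (u : Obj C F) :
    Neutral S (.app t u) := by
  refine ⟨id, fun ⟨f, us, hlen, e⟩ => ?_⟩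
  obtain ⟨vs, rfl, rfl⟩ := apps_fn_eq_app e.symm
  rw [List.length_append] at hlen
  exact ht ⟨f, vs, by omega, rfl⟩

theorem not_isBinder_apps_fn {l : Lvl} (f : F l) (us : List (Obj C F)) :
    ¬ (apps (.fn f : Term C F l) us).IsBinder := by
  induction us using List.reverseRecOn with
  | nil => exact id
  | append_singleton us u _ => rw [apps_concat]; exact id

theorem neutral_apps_fn {l : Lvl} (f : F l) {us : List (Obj C F)}
    (h : S.arity ⟨l, f⟩ ≤ us.length) : Neutral S (apps (.fn f : Term C F l) us) := by
  refine ⟨not_isBinder_apps_fn f us, fun ⟨g, vs, hlen, e⟩ => ?_⟩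
  obtain ⟨rfl, rfl⟩ := apps_fn_inj e
  omega

theorem Step.app_inv_of_not_partialApp (hR : S.FullyApplied R) {l : Lvl} {t s : Term C F l}
    {u : Obj C F} (ht : ¬ PartialApp S t) (h : Step R (.app t u) s) :
    (∃ U b, t = .lam U b ∧ s = b.inst u) ∨
    (∃ t', Step R t t' ∧ s = .app t' u) ∨ ∃ u', Step R u u' ∧ s = .app t u' := by
  rcases h.app_inv with h | ⟨f, ps, r, σ, hr, e, _⟩ | h
  · exact .inl h
  · obtain ⟨vs, hvs, rfl⟩ := apps_fn_eq_app e.symm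
    have hlen : ps.length = vs.length + 1 := by simpa using congrArg List.length hvs
    exact absurd ⟨f, vs, by rw [← hR hr, hlen]; exact vs.length.lt_succ_self, rfl⟩ ht
  · exact .inr h

/-- Girard's reducibility candidates: sets of strongly normalizing terms, closed under reduction,
that contain a neutral term as soon as they contain its reducts. -/
structure IsCand (S : Sig C F) (R : Rules C F) {l : Lvl} (X : Term C F l → Prop) : Prop where
  sn : ∀ ⦃t⦄, X t → SN R t
  step : ∀ ⦃t t'⦄, X t → Step R t t' → X t'
  neutral : ∀ ⦃t⦄, Neutral S t → (∀ t', Step R t t' → X t') → X t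

theorem IsCand.red {l : Lvl} {X : Term C F l → Prop} (hX : IsCand S R X) {t t' : Term C F l}
    (ht : X t) (h : Red R t t') : X t' := by
  induction h with
  | refl => exact ht
  | tail _ h ih => exact hX.step ih h

theorem IsCand.var {X : Obj C F → Prop} (hX : IsCand S R X) (n : ℕ) : X (.var n) :=
  hX.neutral (neutral_var n) fun _ h => (not_step_var h).elim

theorem isCand_sn {l : Lvl} : IsCand S R (SN R (l := l)) :=
  ⟨fun _ h => h, fun _ _ h hs => h.inv hs, fun _ _ h => ⟨_, h⟩⟩

theorem isCand_of_forall_red {l : Lvl} {Φ : Term C F l → Prop} (hΦ : ∀ t, Neutral S t → Φ t) :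
    IsCand S R fun t => SN R t ∧ ∀ s, Red R t s → Φ s := by
  refine ⟨fun t h => h.1, fun t t' h hs => ⟨h.1.inv hs, fun s hr => h.2 s (.head hs hr)⟩,
    fun t ht h => ⟨⟨_, fun t' hs => (h t' hs).1⟩, fun s hr => ?_⟩⟩
  rcases hr.cases_head with rfl | ⟨t', hs, hr⟩
  exacts [hΦ t ht, (h t' hs).2 s hr]

theorem IsCand.beta (hR : S.FullyApplied R) {l : Lvl} {X : Term C F l → Prop}
    (hX : IsCand S R X) {U : Ty C F} {t : Term C F l} {u : Obj C F} (hU : SN R U) (ht : SN R t)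
    (hu : SN R u) (h : X (t.inst u)) : X (.app (.lam U t) u) := by
  induction hU generalizing t u with
  | intro U _ ihU =>
    induction ht generalizing u with
    | intro t ht iht =>
      induction hu with
      | intro u hu ihu =>
        refine hX.neutral (neutral_app (not_partialApp_lam _ _) _) fun s hs => ?_
        rcases hs.app_inv_of_not_partialApp hR (not_partialApp_lam _ _) with
          ⟨_, _, e, rfl⟩ | ⟨t', hs', rfl⟩ | ⟨u', hs', rfl⟩
        · cases e; exact h
        · rcases step_lam_iff.1 hs' with ⟨U', hs'', rfl⟩ | ⟨t'', hs'', rfl⟩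
          · exact ihU _ hs'' ⟨_, ht⟩ ⟨_, hu⟩ h
          · exact iht _ hs'' ⟨_, hu⟩ (hX.step h (hs''.subst _))
        · exact ihu _ hs' (hX.red h (t.red_inst (.single hs')))

/-- The terms whose application to any `u` in `P` is in `Q u`. -/
def Arrow {l : Lvl} (P : Obj C F → Prop) (Q : Obj C F → Term C F l → Prop) (t : Term C F l) :
    Prop :=
  ∀ u, P u → Q u (.app t u)

theorem IsCand.arrow (hR : S.FullyApplied R) {l : Lvl} {P : Obj C F → Prop}
    {Q : Obj C F → Term C F l → Prop} (hP : IsCand S R P) (hQ : ∀ u, P u → IsCand S R (Q u))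
    (hstep : ∀ u u', P u → Step R u u' → Q u' = Q u) : IsCand S R (Arrow P Q) := by
  refine ⟨fun t ht => ?_, fun t t' ht hs u hu => ?_, fun t hn ht u hu => ?_⟩
  · exact ((hQ _ (hP.var 0)).sn (ht _ (hP.var 0))).of_app_left
  · exact (hQ u hu).step (ht u hu) (.appFun u hs)
  · induction hP.sn hu with
    | intro u _ ihu =>
      refine (hQ u hu).neutral (neutral_app hn.2 u) fun s hs => ?_
      rcases hs.app_inv_of_not_partialApp hR hn.2 with
        ⟨_, _, rfl, _⟩ | ⟨t', hs', rfl⟩ | ⟨u', hs', rfl⟩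
      · exact absurd trivial hn.1
      · exact ht t' hs' u hu
      · rw [← hstep u u' hu hs']
        exact ihu u' hs' (hP.step hu hs')

theorem forall₂_trans {α : Type*} {r : α → α → Prop} [IsTrans α r] {as bs cs : List α}
    (h : List.Forall₂ r as bs) (h' : List.Forall₂ r bs cs) : List.Forall₂ r as cs := by
  induction h generalizing cs with
  | nil => exact h'
  | cons h _ ih =>
    cases h' with
    | cons h' hs => exact .cons (_root_.trans h h') (ih hs)

theorem IsCand.apps_fn (hR : S.FullyApplied R) {l : Lvl} {X : Term C F l → Prop}
    (hX : IsCand S R X) {f : F l} {ts : List (Obj C F)} (hlen : ts.length = S.arity ⟨l, f⟩)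
    (hts : Terminates (ListStep (Step R)) ts)
    (hrule : ∀ ps r σ, R f ps r → List.Forall₂ (Red R) ts (ps.map (Term.subst σ)) →
      X (r.subst σ)) : X (apps (.fn f) ts) := by
  induction hts with
  | intro ts _ ih =>
    refine hX.neutral (neutral_apps_fn f hlen.ge) fun s hs => ?_
    rcases hs.apps_fn_inv hR hlen.le with ⟨ps, r, σ, hr, rfl, rfl⟩ | ⟨ts', hts', rfl⟩
    · exact hrule ps r σ hr (List.forall₂_refl _)
    · exact ih ts' hts' (hts'.length_eq.symm.trans hlen) fun ps r σ hr h =>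
        hrule ps r σ hr (forall₂_trans hts'.forall₂ h)

/-! ### Interpretable types -/

/-- `Interp R T P`: the type `T` is interpreted by the set of objects `P`. Both cases are read up to
conversion, so that confluence makes the interpretation unique and invariant under conversion. -/
inductive Interp (R : Rules C F) : Ty C F → (Obj C F → Prop) → Prop
  | pi {T U V : Ty C F} {P : Obj C F → Prop} {Q : Obj C F → Obj C F → Prop} :
      Conv R T (.pi U V) → Interp R U P → (∀ u, P u → Interp R (V.inst u) (Q u)) →
      Interp R T (Arrow P Q)
  | base {T : Ty C F} : (∀ U V, ¬ Conv R T (.pi U V)) → Interp R T (SN R)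

/-- `T` has an interpretation. -/
def Interpretable (R : Rules C F) (T : Ty C F) : Prop := ∃ P, Interp R T P

theorem Interp.conv {T T' : Ty C F} {P : Obj C F → Prop} (h : Interp R T P) (hT : Conv R T T') :
    Interp R T' P := by
  cases h with
  | pi hc hU hV => exact .pi (hT.symm.trans hc) hU hV
  | base hc => exact .base fun U V h => hc U V (hT.trans h)

theorem Interpretable.conv {T T' : Ty C F} (h : Interpretable R T) (hT : Conv R T T') :
    Interpretable R T' :=
  h.imp fun _ h => h.conv hT

theorem Interp.unique (hconf : ConfluentOnTypes R) {T T' : Ty C F} {P P' : Obj C F → Prop}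
    (h : Interp R T P) (h' : Interp R T' P') (hT : Conv R T T') : P = P' := by
  induction h generalizing T' P' with
  | pi hc _ _ ihU ihV =>
    cases h' with
    | pi hc' hU' hV' =>
      obtain ⟨hUU', hVV'⟩ := Conv.pi_inj hconf ((hc.symm.trans hT).trans hc')
      obtain rfl := ihU hU' hUU'
      funext t
      refine propext (forall₂_congr fun u hu => ?_)
      rw [ihV u hu (hV' u hu) (hVV'.subst _)]
    | base hc' => exact absurd (hT.symm.trans hc) (hc' _ _)
  | base hc =>
    cases h' with
    | pi hc' => exact absurd (hT.trans hc') (hc _ _)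
    | base => rfl

theorem Interp.isCand (hR : S.FullyApplied R) (hconf : ConfluentOnTypes R) {T : Ty C F}
    {P : Obj C F → Prop} (h : Interp R T P) : IsCand S R P := by
  induction h with
  | base => exact isCand_sn
  | @pi _ _ V P Q _ _ hV ihU ihV =>
    refine ihU.arrow hR ihV fun u u' hu hs => ?_
    exact (hV u' (ihU.step hu hs)).unique hconf (hV u hu) (V.red_inst (.single hs)).conv.symm

theorem Interp.pi_inv (hconf : ConfluentOnTypes R) {U V : Ty C F} {X : Obj C F → Prop}
    (h : Interp R (.pi U V) X) :
    ∃ (P : Obj C F → Prop) (Q : Obj C F → Obj C F → Prop), Interp R U P ∧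
      (∀ u, P u → Interp R (V.inst u) (Q u)) ∧ X = Arrow P Q := by
  generalize hT : Term.pi U V = T at h
  cases h with
  | @pi _ U' V' P Q hc hU hV =>
    subst hT
    obtain ⟨hUU', hVV'⟩ := Conv.pi_inj hconf hc
    exact ⟨P, Q, hU.conv hUU'.symm, fun u hu => (hV u hu).conv (hVV'.symm.subst _), rfl⟩
  | base hc => subst hT; exact absurd (.refl _) (hc _ _)

/-! ### Computable objects and types -/

/-- Computable objects of an arbitrary type. Calls have to be shown computable before their type is
known to be interpretable, hence the second case: an object of a type without interpretation is
computable if none of its reducts is a partial application and if its reducts that are abstractions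
have an interpretable domain and map computable objects to computable objects. -/
inductive Comp (S : Sig C F) (R : Rules C F) : Ty C F → Obj C F → Prop
  | interp {T : Ty C F} {P : Obj C F → Prop} {t : Obj C F} : Interp R T P → P t → Comp S R T t
  | other {T : Ty C F} {t : Obj C F} : ¬ Interpretable R T → SN R t →
      (∀ s, Red R t s → ¬ PartialApp S s) →
      (∀ U b U' B, Red R t (.lam U b) → Conv R T (.pi U' B) →
        Conv R U U' ∧ Interpretable R U) →
      (∀ U b U' B P u, Red R t (.lam U b) → Conv R T (.pi U' B) → Interp R U P → P u →
        Comp S R (B.inst u) (b.inst u)) → Comp S R T t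

/-- The condition that the computability of an object of a type `T` without interpretation imposes
on each of its reducts `s`. -/
def Applicable (S : Sig C F) (R : Rules C F) (T : Ty C F) (s : Obj C F) : Prop :=
  ¬ PartialApp S s ∧ ∀ U b U' B, s = .lam U b → Conv R T (.pi U' B) →
    Conv R U U' ∧ Interpretable R U ∧
      ∀ P u, Interp R U P → P u → Comp S R (B.inst u) (b.inst u)

theorem comp_iff_of_not_interpretable {T : Ty C F} (hT : ¬ Interpretable R T) {t : Obj C F} :
    Comp S R T t ↔ SN R t ∧ ∀ s, Red R t s → Applicable S R T s := by
  constructor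
  · intro h
    cases h with
    | interp h => exact absurd ⟨_, h⟩ hT
    | other _ hsn hp hl hb =>
      refine ⟨hsn, fun s hs => ⟨hp s hs, ?_⟩⟩
      rintro U b U' B rfl hc
      obtain ⟨hUU', hU⟩ := hl U b U' B hs hc
      exact ⟨hUU', hU, fun P u hP hu => hb U b U' B P u hs hc hP hu⟩
  · rintro ⟨hsn, h⟩
    refine .other hT hsn (fun s hs => (h s hs).1) (fun U b U' B hs hc => ?_)
      fun U b U' B P u hs hc => ((h _ hs).2 U b U' B rfl hc).2.2 P u
    obtain ⟨hUU', hU, -⟩ := (h _ hs).2 U b U' B rfl hc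
    exact ⟨hUU', hU⟩

theorem Applicable.of_neutral {t : Obj C F} (ht : Neutral S t) (T : Ty C F) :
    Applicable S R T t := by
  refine ⟨ht.2, ?_⟩
  rintro U b _ _ rfl
  exact absurd trivial ht.1

theorem Interp.comp_iff (hconf : ConfluentOnTypes R) {T : Ty C F} {P : Obj C F → Prop}
    (h : Interp R T P) {t : Obj C F} : Comp S R T t ↔ P t := by
  refine ⟨fun ht => ?_, .interp h⟩
  cases ht with
  | interp h' ht => rwa [h.unique hconf h' (.refl _)]
  | other hn => exact absurd ⟨P, h⟩ hn

theorem Comp.conv {T T' : Ty C F} {t : Obj C F} (h : Comp S R T t) (hT : Conv R T T') :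
    Comp S R T' t := by
  cases h with
  | interp h ht => exact .interp (h.conv hT) ht
  | other hn hsn hp hl hb =>
    exact .other (fun h => hn (h.conv hT.symm)) hsn hp
      (fun U b U' B hr hc => hl U b U' B hr (hT.trans hc))
      (fun U b U' B P u hr hc => hb U b U' B P u hr (hT.trans hc))

theorem comp_eq_of_conv {T T' : Ty C F} (hT : Conv R T T') : Comp S R T = Comp S R T' :=
  funext fun _ => propext ⟨fun h => h.conv hT, fun h => h.conv hT.symm⟩

theorem isCand_comp (hR : S.FullyApplied R) (hconf : ConfluentOnTypes R) (T : Ty C F) :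
    IsCand S R (Comp S R T) := by
  by_cases hT : Interpretable R T
  · obtain ⟨P, hP⟩ := hT
    rw [show Comp S R T = P from funext fun t => propext (hP.comp_iff hconf)]
    exact hP.isCand hR hconf
  · rw [show Comp S R T = _ from funext fun t => propext (comp_iff_of_not_interpretable hT)]
    exact isCand_of_forall_red fun t ht => .of_neutral ht T

/-- Computable types of kind `Type`. -/
def CompTy (R : Rules C F) (T : Ty C F) : Prop := SN R T ∧ Interpretable R T

theorem Comp.lam (hR : S.FullyApplied R) (hconf : ConfluentOnTypes R) {U B : Ty C F}
    {t : Obj C F} (hU : CompTy R U) (ht : ∀ u, Comp S R U u → Comp S R (B.inst u) (t.inst u)) :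
    Comp S R (.pi U B) (.lam U t) := by
  have htsn : SN R t :=
    ((isCand_comp hR hconf _).sn (ht _ ((isCand_comp hR hconf U).var 0))).of_subst
  obtain ⟨hUsn, P, hP⟩ := hU
  by_cases hI : Interpretable R (.pi U B)
  · obtain ⟨X, hX⟩ := hI
    obtain ⟨P', Q, hP', hQ, rfl⟩ := hX.pi_inv hconf
    refine .interp hX fun u hu => ?_
    exact ((hQ u hu).isCand hR hconf).beta hR hUsn htsn ((hP'.isCand hR hconf).sn hu)
      (((hQ u hu).comp_iff hconf).1 (ht u (.interp hP' hu)))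
  · refine (comp_iff_of_not_interpretable hI).2 ⟨hUsn.lam htsn, fun s hs => ?_⟩
    obtain ⟨U', t', rfl, hUU', htt'⟩ := Red.lam_inv hs
    refine ⟨not_partialApp_lam _ _, fun U₁ b U₂ B₂ e hc => ?_⟩
    cases e
    obtain ⟨hUU₂, hBB₂⟩ := Conv.pi_inj hconf hc
    refine ⟨hUU'.conv.symm.trans hUU₂, ⟨P, hP.conv hUU'.conv⟩, fun P' u hP' hu => ?_⟩
    have hu : Comp S R U u := .interp (hP'.conv hUU'.conv.symm) hu
    exact ((isCand_comp hR hconf _).red (ht u hu) (htt'.subst _)).conv (hBB₂.subst _)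

theorem Comp.app (hR : S.FullyApplied R) (hconf : ConfluentOnTypes R) {U B : Ty C F}
    {t u : Obj C F} (ht : Comp S R (.pi U B) t) (hu : Comp S R U u) :
    Comp S R (B.inst u) (.app t u) := by
  by_cases hI : Interpretable R (.pi U B)
  · obtain ⟨X, hX⟩ := hI
    have htX : X t := (hX.comp_iff hconf).1 ht
    obtain ⟨P, Q, hP, hQ, rfl⟩ := hX.pi_inv hconf
    have huP : P u := (hP.comp_iff hconf).1 hu
    exact .interp (hQ u huP) (htX u huP)
  · have hcand := fun T => isCand_comp (S := S) hR hconf T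
    induction (hcand _).sn ht generalizing u with
    | intro t _ iht =>
      induction (hcand _).sn hu with
      | intro u _ ihu =>
        obtain ⟨hpartial, hlam⟩ := ((comp_iff_of_not_interpretable hI).1 ht).2 t .refl
        refine (hcand _).neutral (neutral_app hpartial u) fun s hs => ?_
        rcases hs.app_inv_of_not_partialApp hR hpartial with
          ⟨U', b, rfl, rfl⟩ | ⟨t', hs', rfl⟩ | ⟨u', hs', rfl⟩
        · obtain ⟨hUU', ⟨P, hP⟩, hb⟩ := hlam U' b U B rfl (.refl _)
          exact hb P u hP (((hP.conv hUU').comp_iff hconf).1 hu)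
        · exact iht t' hs' ((hcand _).step ht hs') hu
        · exact (ihu u' hs' ((hcand _).step hu hs')).conv
            (B.red_inst (.single hs')).conv.symm

theorem CompTy.of_conHeaded (hconf : ConfluentOnTypes R) {T : Ty C F} (hT : T.ConHeaded)
    (hsn : SN R T) : CompTy R T :=
  ⟨hsn, _, .base fun _ _ => hT.not_conv_pi hconf⟩

theorem Neutral.not_conv_pi_of_normal (hconf : ConfluentOnTypes R) {T U V : Ty C F}
    (hT : Neutral S T) (hnormal : ∀ T', ¬ Step R T T') : ¬ Conv R T (.pi U V) := by
  intro hc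
  obtain ⟨s, hTs, hs⟩ := hconf.join_of_eqvGen hc
  obtain ⟨U', V', rfl, -, -⟩ := Red.pi_inv hs
  rcases hTs.cases_head with rfl | ⟨T', hTT', -⟩
  exacts [hT.1 trivial, hnormal T' hTT']

theorem isCand_compTy (hconf : ConfluentOnTypes R) : IsCand S R (CompTy R) := by
  refine ⟨fun T h => h.1, fun T T' h hs => ⟨h.1.inv hs, h.2.conv (.rel _ _ hs)⟩, fun T hn h => ?_⟩
  refine ⟨⟨_, fun T' hs => (h T' hs).1⟩, ?_⟩
  by_cases hT : ∃ T', Step R T T'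
  · obtain ⟨T', hs⟩ := hT
    exact (h T' hs).2.conv (Conv.symm (.rel _ _ hs))
  · exact ⟨_, .base fun U V => hn.not_conv_pi_of_normal hconf (not_exists.1 hT)⟩

theorem CompTy.pi (hR : S.FullyApplied R) (hconf : ConfluentOnTypes R) {U V : Ty C F}
    (hU : CompTy R U) (hV : ∀ u, Comp S R U u → CompTy R (V.inst u)) : CompTy R (.pi U V) := by
  have hVsn : SN R V := (hV _ ((isCand_comp hR hconf U).var 0)).1.of_subst
  obtain ⟨hUsn, P, hP⟩ := hU
  choose Q hQ using fun u (hu : P u) => (hV u (.interp hP hu)).2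
  classical
  refine ⟨hUsn.pi hVsn, _, .pi (Q := fun u => if hu : P u then Q u hu else fun _ => False)
    (.refl _) hP fun u hu => ?_⟩
  rw [dif_pos hu]
  exact hQ u hu

/-- Computable types of kind `K`, the free variables of `K` being instantiated by `σ`. -/
def KComp (S : Sig C F) (R : Rules C F) : Kd C F → (ℕ → Obj C F) → Ty C F → Prop
  | .type, _ => CompTy R
  | .pi U K, σ => Arrow (Comp S R (U.subst σ)) fun u => KComp S R K (scons u σ)

theorem kComp_subst (K : Kd C F) (ρ σ : ℕ → Obj C F) :
    KComp S R (K.subst ρ) σ = KComp S R K (fun n => (ρ n).subst σ) := by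
  induction K generalizing ρ σ with
  | type => rfl
  | pi U K ih => simp only [Kd.subst, KComp, Term.subst_subst, ih, liftSub_subst_scons]

theorem kComp_inst (K : Kd C F) (u : Obj C F) (σ : ℕ → Obj C F) :
    KComp S R (K.inst u) σ = KComp S R K (scons (u.subst σ) σ) := by
  simp only [Kd.inst, kComp_subst, single_eq_scons, scons_subst, Term.subst]

theorem kComp_eq_of_conv {K K' : Kd C F} (h : Relation.EqvGen (KStep R) K K')
    (σ : ℕ → Obj C F) : KComp S R K σ = KComp S R K' σ := by
  induction h with
  | rel K K' h =>
    induction h generalizing σ with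
    | piDom K h => simp only [KComp, comp_eq_of_conv (S := S) (.rel _ _ (h.subst σ))]
    | piCod U _ ih => simp only [KComp, ih]
  | refl => rfl
  | symm _ _ _ ih => exact ih.symm
  | trans _ _ _ _ _ ih₁ ih₂ => exact ih₁.trans ih₂

theorem kComp_eq_of_red (K : Kd C F) {σ σ' : ℕ → Obj C F} (h : ∀ n, Red R (σ n) (σ' n)) :
    KComp S R K σ = KComp S R K σ' := by
  induction K generalizing σ σ' with
  | type => rfl
  | pi U K ih =>
    have hK : ∀ u, KComp S R K (scons u σ) = KComp S R K (scons u σ') := fun u =>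
      ih fun | 0 => .refl | n + 1 => h n
    simp only [KComp, comp_eq_of_conv (S := S) (U.red_subst h).conv, hK]

theorem isCand_kComp (hR : S.FullyApplied R) (hconf : ConfluentOnTypes R) (K : Kd C F)
    (σ : ℕ → Obj C F) : IsCand S R (KComp S R K σ) := by
  induction K generalizing σ with
  | type => exact isCand_compTy hconf
  | pi U K ih =>
    exact (isCand_comp hR hconf _).arrow hR (fun u _ => ih _) fun u u' _ hs =>
      (kComp_eq_of_red K (red_scons (.single hs) σ)).symm

theorem kComp_of_conHeaded (hR : S.FullyApplied R) (hconf : ConfluentOnTypes R) (K : Kd C F)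
    (σ : ℕ → Obj C F) {T : Ty C F} (hT : T.ConHeaded) (hsn : SN R T) : KComp S R K σ T := by
  induction K generalizing σ T with
  | type => exact .of_conHeaded hconf hT hsn
  | pi U _ ih =>
    exact fun u hu => ih _ hT (.app_of_conHeaded hT hsn ((isCand_comp hR hconf _).sn hu))

theorem kComp_lam (hR : S.FullyApplied R) (hconf : ConfluentOnTypes R) {U : Ty C F} {K : Kd C F}
    {σ : ℕ → Obj C F} {T : Ty C F} (hU : SN R (U.subst σ))
    (hT : ∀ u, Comp S R (U.subst σ) u → KComp S R K (scons u σ) (T.inst u)) :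
    KComp S R (.pi U K) σ (.lam (U.subst σ) T) := by
  intro u hu
  have hUc : IsCand S R (Comp S R (U.subst σ)) := isCand_comp hR hconf _
  have hTsn : SN R T := ((isCand_kComp hR hconf K _).sn (hT _ (hUc.var 0))).of_subst
  exact (isCand_kComp hR hconf K _).beta hR hU hTsn (hUc.sn hu) (hT u hu)

/-! ### Computable arguments -/

/-- The `us` are computable arguments for the type `A`, leaving the type `B`. -/
inductive TyArgs (S : Sig C F) (R : Rules C F) : Ty C F → List (Obj C F) → Ty C F → Prop
  | nil (A : Ty C F) : TyArgs S R A [] A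
  | cons {A B B' : Ty C F} {u : Obj C F} {us : List (Obj C F)} : Comp S R A u →
      TyArgs S R (B.inst u) us B' → TyArgs S R (.pi A B) (u :: us) B'

/-- The `us` are computable arguments, in the right number, for the kind `K` whose free variables
are instantiated by `σ`. -/
def KdArgs (S : Sig C F) (R : Rules C F) : Kd C F → (ℕ → Obj C F) → List (Obj C F) → Prop
  | .type, _, [] => True
  | .pi U K, σ, u :: us => Comp S R (U.subst σ) u ∧ KdArgs S R K (scons u σ) us
  | _, _, _ => False

theorem Term.exists_eq_pi_of_arity_pos {T : Ty C F} (h : 0 < T.arity) : ∃ U V, T = .pi U V := by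
  cases T with
  | pi U V => exact ⟨U, V, rfl⟩
  | _ => simp [Term.arity] at h

theorem TyArgs.sn (hR : S.FullyApplied R) (hconf : ConfluentOnTypes R) {A B : Ty C F}
    {us : List (Obj C F)} (h : TyArgs S R A us B) : ∀ u ∈ us, SN R u := by
  induction h with
  | nil => exact fun _ h => absurd h List.not_mem_nil
  | cons hu _ ih => exact List.forall_mem_cons.2 ⟨(isCand_comp hR hconf _).sn hu, ih⟩

theorem TyArgs.red (hR : S.FullyApplied R) (hconf : ConfluentOnTypes R) {A A' B : Ty C F}
    {us us' : List (Obj C F)} (h : TyArgs S R A us B) (hA : Conv R A A')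
    (hlen : us.length ≤ A'.arity) (hus : List.Forall₂ (Red R) us us') :
    ∃ B', TyArgs S R A' us' B' ∧ Conv R B B' := by
  induction h generalizing A' us' with
  | nil A => cases hus; exact ⟨A', .nil _, hA⟩
  | @cons A B _ u us hu _ ih =>
    cases hus with
    | @cons _ u' _ us' hu' hus =>
      obtain ⟨U', V', rfl⟩ := Term.exists_eq_pi_of_arity_pos ((Nat.succ_pos _).trans_le hlen)
      obtain ⟨hAU', hBV'⟩ := Conv.pi_inj hconf hA
      have hinst : Conv R (B.inst u) (V'.inst u') := (hBV'.subst _).trans (V'.red_inst hu').conv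
      have hlen' : us.length ≤ (V'.inst u').arity := by
        rw [Term.inst, Term.arity_subst]
        exact Nat.le_of_succ_le_succ hlen
      obtain ⟨B'', hB'', hc⟩ := ih hinst hlen' hus
      exact ⟨B'', .cons (((isCand_comp hR hconf _).red hu hu').conv hAU') hB'', hc⟩

theorem TyArgs.eq_resultTy {T B : Ty C F} {ps : List (Obj C F)} {σ : ℕ → Obj C F}
    (h : TyArgs S R (T.subst σ) (ps.map (Term.subst σ)) B) : B = (resultTy T ps).subst σ := by
  induction ps generalizing T with
  | nil =>
    generalize hT : T.subst σ = T' at h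
    cases h
    exact hT.symm
  | cons p ps ih =>
    cases T with
    | pi U V =>
      cases h with
      | cons _ h =>
        rw [← Term.inst_subst_comm] at h
        exact ih h
    | _ => cases h

theorem KdArgs.sn (hR : S.FullyApplied R) (hconf : ConfluentOnTypes R) {K : Kd C F}
    {σ : ℕ → Obj C F} {us : List (Obj C F)} (h : KdArgs S R K σ us) : ∀ u ∈ us, SN R u := by
  fun_induction KdArgs S R K σ us with
  | case1 => exact fun _ h => absurd h List.not_mem_nil
  | case2 U K σ u us ih =>
    exact List.forall_mem_cons.2 ⟨(isCand_comp hR hconf _).sn h.1, ih h.2⟩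
  | case3 => exact h.elim

theorem KdArgs.length_eq {K : Kd C F} {σ : ℕ → Obj C F} {us : List (Obj C F)}
    (h : KdArgs S R K σ us) : us.length = K.arity := by
  fun_induction KdArgs S R K σ us with
  | case1 => rfl
  | case2 U K σ u us ih => exact congrArg Nat.succ (ih h.2)
  | case3 => exact h.elim

theorem KdArgs.red (hR : S.FullyApplied R) (hconf : ConfluentOnTypes R) {K : Kd C F}
    {σ σ' : ℕ → Obj C F} {us us' : List (Obj C F)} (h : KdArgs S R K σ us)
    (hσ : ∀ n, Red R (σ n) (σ' n)) (hus : List.Forall₂ (Red R) us us') :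
    KdArgs S R K σ' us' := by
  fun_induction KdArgs S R K σ us generalizing σ' us' with
  | case1 => cases hus; trivial
  | case2 U K σ u us ih =>
    cases hus with
    | cons hu hus =>
      exact ⟨((isCand_comp hR hconf _).red h.1 hu).conv (U.red_subst hσ).conv,
        ih h.2 (fun | 0 => hu | n + 1 => hσ n) hus⟩
  | case3 => exact h.elim

theorem kdArgs_subst (K : Kd C F) (ρ σ : ℕ → Obj C F) (us : List (Obj C F)) :
    KdArgs S R (K.subst ρ) σ us ↔ KdArgs S R K (fun n => (ρ n).subst σ) us := by
  induction K generalizing ρ σ us with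
  | type => cases us <;> exact .rfl
  | pi U K ih =>
    cases us with
    | nil => exact .rfl
    | cons u us => simp only [Kd.subst, KdArgs, Term.subst_subst, ih, liftSub_subst_scons]

theorem kdArgs_inst (K : Kd C F) (u : Obj C F) (σ : ℕ → Obj C F) (us : List (Obj C F)) :
    KdArgs S R (K.inst u) σ us ↔ KdArgs S R K (scons (u.subst σ) σ) us := by
  simp only [Kd.inst, kdArgs_subst, single_eq_scons, scons_subst, Term.subst]

theorem kdArgs_iff_of_closed {K : Kd C F} (hK : ∀ σ, K.subst σ = K) (σ ρ : ℕ → Obj C F)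
    (us : List (Obj C F)) : KdArgs S R K σ us ↔ KdArgs S R K ρ us := by
  have hvar : ∀ σ, KdArgs S R K σ us ↔ KdArgs S R K .var us := fun σ => by
    conv_rhs => rw [← hK σ, kdArgs_subst]
    simp only [Term.subst_var]
  rw [hvar σ, hvar ρ]

theorem Interp.of_tyArgs (hconf : ConfluentOnTypes R) {T : Ty C F} {P : Obj C F → Prop}
    {t : Obj C F} (hP : Interp R T P)
    (h : ∀ us B, us.length = T.arity → TyArgs S R T us B → Comp S R B (apps t us)) : P t := by
  induction hn : T.arity generalizing T P t with
  | zero => exact (hP.comp_iff hconf).1 (h [] T hn.symm (.nil _))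
  | succ n ih =>
    obtain ⟨U, V, rfl⟩ := Term.exists_eq_pi_of_arity_pos (T := T) (by omega)
    obtain ⟨P', Q, hP', hQ, rfl⟩ := hP.pi_inv hconf
    have harity : ∀ u, (V.inst u).arity = V.arity := fun u => Term.arity_subst V _
    intro u hu
    refine ih (hQ u hu) (fun us B hlen hB => ?_) ((harity u).trans (Nat.succ.inj hn))
    exact h (u :: us) B (congrArg Nat.succ (hlen.trans (harity u))) (.cons (.interp hP' hu) hB)

theorem kComp_of_kdArgs {K : Kd C F} {σ : ℕ → Obj C F} {T : Ty C F}
    (h : ∀ us, KdArgs S R K σ us → CompTy R (apps T us)) : KComp S R K σ T := by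
  induction K generalizing σ T with
  | type => exact h [] trivial
  | pi U K ih => exact fun u hu => ih fun us hus => h (u :: us) ⟨hu, hus⟩

/-! ### Variables of left-hand sides -/

theorem Sig.IsData.conHeaded {T : Ty C F} (h : S.IsData T) : T.ConHeaded := by
  obtain ⟨D, us, -, rfl⟩ := h
  exact (conHeaded_apps _ us).2 trivial

theorem Sig.IsData.subst {T : Ty C F} (h : S.IsData T) (σ : ℕ → Obj C F) :
    S.IsData (T.subst σ) := by
  obtain ⟨D, us, hlen, rfl⟩ := h
  exact ⟨D, us.map (Term.subst σ), by rwa [List.length_map], apps_subst _ _ _⟩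

theorem Sig.IsCtorType.subst {T : Ty C F} (h : S.IsCtorType T) (σ : ℕ → Obj C F) :
    S.IsCtorType (T.subst σ) := by
  induction h generalizing σ with
  | data h => exact .data (h.subst σ)
  | arrow h _ ih => exact .arrow (h.subst σ) (ih _)

theorem Sig.IsCtorType.pi_inv {A B : Ty C F} (h : S.IsCtorType (.pi A B)) :
    S.IsData A ∧ S.IsCtorType B := by
  cases h with
  | data h => exact h.conHeaded.elim
  | arrow hA hB => exact ⟨hA, hB⟩

theorem SN.subst_of_mem_apps {t : Obj C F} {us : List (Obj C F)} {σ : ℕ → Obj C F}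
    (h : SN R ((apps t us).subst σ)) : ∀ u ∈ us, SN R (u.subst σ) := by
  rw [apps_subst] at h
  exact fun u hu => h.of_apps.2 _ (List.mem_map_of_mem hu)

/-- The arguments of a constructor have base types, interpreted by strong normalization, and
subterms of strongly normalizing terms are strongly normalizing. -/
theorem AccTy.comp_of_isCtorType (hconf : ConfluentOnTypes R) {T A : Ty C F}
    {qs : List (Obj C F)} {x : ℕ} {σ : ℕ → Obj C F} (h : AccTy S T qs x A)
    (hT : S.IsCtorType T) (hqs : ∀ q ∈ qs, SN R (q.subst σ)) : Comp S R (A.subst σ) (σ x) := by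
  induction h with
  | here =>
    exact .interp (.base fun _ _ => (hT.pi_inv.1.subst σ).conHeaded.not_conv_pi hconf)
      (List.forall_mem_cons.1 hqs).1
  | inside hc _ _ ih => exact ih hc (List.forall_mem_cons.1 hqs).1.subst_of_mem_apps
  | there _ ih => exact ih (hT.pi_inv.2.subst _) (List.forall_mem_cons.1 hqs).2

theorem AccTy.comp (hR : S.FullyApplied R) (hconf : ConfluentOnTypes R) {T A B : Ty C F}
    {ps : List (Obj C F)} {x : ℕ} {σ : ℕ → Obj C F} (h : AccTy S T ps x A)
    (hps : TyArgs S R (T.subst σ) (ps.map (Term.subst σ)) B) : Comp S R (A.subst σ) (σ x) := by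
  induction h with
  | here =>
    cases hps with
    | cons hx _ => exact hx
  | inside hc _ h _ =>
    exact h.comp_of_isCtorType hconf hc
      (hps.sn hR hconf _ List.mem_cons_self).subst_of_mem_apps
  | there _ ih =>
    cases hps with
    | cons _ h =>
      rw [← Term.inst_subst_comm] at h
      exact ih h

theorem AccKd.comp (hR : S.FullyApplied R) (hconf : ConfluentOnTypes R) {K : Kd C F}
    {A : Ty C F} {ps : List (Obj C F)} {x : ℕ} {σ : ℕ → Obj C F} (h : AccKd S K ps x A)
    (hps : KdArgs S R K σ (ps.map (Term.subst σ))) : Comp S R (A.subst σ) (σ x) := by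
  induction h with
  | here => exact hps.1
  | inside hc _ h =>
    exact h.comp_of_isCtorType hconf hc
      (hps.sn hR hconf _ List.mem_cons_self).subst_of_mem_apps
  | there _ ih => exact ih ((kdArgs_inst _ _ _ _).2 hps.2)

/-! ### Validity of the computability closure -/

/-- The application of a symbol with a well-formed type or kind to `ts` is computable whenever the
`ts` are computable arguments for it. -/
def CallComp (S : Sig C F) (R : Rules C F) : Sym F → List (Obj C F) → Prop
  | ⟨.obj, f⟩, ts => Deriv S R (.ty [] (S.objFn f) .type) → ts.length = S.arity ⟨.obj, f⟩ →
      ∀ B, TyArgs S R (S.objFn f) ts B → Comp S R B (apps (.fn f) ts)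
  | ⟨.ty, f⟩, ts => Deriv S R (.kind [] (S.tyFn f)) → KdArgs S R (S.tyFn f) .var ts →
      CompTy R (apps (.fn f) ts)

/-- Computable environments: `ρ` instantiates the variables of `Γ` by computable objects. -/
def CompEnv (S : Sig C F) (R : Rules C F) (Γ : List (Ty C F)) (ρ : ℕ → Obj C F) : Prop :=
  ∀ n A, Γ[n]? = some A → Comp S R ((A.shift (n + 1)).subst ρ) (ρ n)

theorem compEnv_nil (ρ : ℕ → Obj C F) : CompEnv S R [] ρ :=
  fun _ _ h => absurd h nofun

theorem CompEnv.cons {ρ : ℕ → Obj C F} {Γ : List (Ty C F)} (h : CompEnv S R Γ ρ) {U : Ty C F}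
    {u : Obj C F} (hu : Comp S R (U.subst ρ) u) : CompEnv S R (U :: Γ) (scons u ρ) := by
  intro n A hA
  rw [Term.shift_succ_subst_scons]
  cases n with
  | zero =>
    obtain rfl : U = A := Option.some.inj hA
    rwa [Term.shift_zero]
  | succ n => exact h n A hA

theorem compEnv_var (hR : S.FullyApplied R) (hconf : ConfluentOnTypes R) (Γ : List (Ty C F)) :
    CompEnv S R Γ .var :=
  fun n _ _ => (isCand_comp hR hconf _).var n

/-- Validity of the judgments of the computability closure of a left-hand side instantiated by `σ`.
The arguments in a derivation of `CC` for a call exhaust the arity of its head, so that validity of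
`kdArgs` need only be stated for full argument lists. -/
def CJudg.Valid (S : Sig C F) (R : Rules C F) (σ : ℕ → Obj C F) : CJudg C F → Prop
  | .obj Γ t A => ∀ ρ, (∀ n, ρ (n + Γ.length) = σ n) → CompEnv S R Γ ρ →
      Comp S R (A.subst ρ) (t.subst ρ)
  | .ty Γ T K => ∀ ρ, (∀ n, ρ (n + Γ.length) = σ n) → CompEnv S R Γ ρ → KComp S R K ρ (T.subst ρ)
  | .tyArgs Γ A us B => ∀ ρ, (∀ n, ρ (n + Γ.length) = σ n) → CompEnv S R Γ ρ →
      TyArgs S R (A.subst ρ) (us.map (Term.subst ρ)) (B.subst ρ)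
  | .kdArgs Γ K us K' => us.length = K.arity → K' = .type ∧
      ∀ ρ, (∀ n, ρ (n + Γ.length) = σ n) → CompEnv S R Γ ρ →
        KdArgs S R K ρ (us.map (Term.subst ρ))

theorem CompTy.subst_pi (hR : S.FullyApplied R) (hconf : ConfluentOnTypes R) {U T : Ty C F}
    {ρ : ℕ → Obj C F} (hU : CompTy R (U.subst ρ))
    (hT : ∀ u, Comp S R (U.subst ρ) u → CompTy R (T.subst (scons u ρ))) :
    CompTy R ((Term.pi U T).subst ρ) :=
  .pi hR hconf hU fun u hu => (T.subst_liftSub_inst ρ u).symm ▸ hT u hu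

theorem kComp_subst_lam (hR : S.FullyApplied R) (hconf : ConfluentOnTypes R) {U T : Ty C F}
    {K : Kd C F} {ρ : ℕ → Obj C F} (hU : CompTy R (U.subst ρ))
    (hT : ∀ u, Comp S R (U.subst ρ) u → KComp S R K (scons u ρ) (T.subst (scons u ρ))) :
    KComp S R (.pi U K) ρ ((Term.lam U T).subst ρ) :=
  kComp_lam hR hconf hU.1 fun u hu => (T.subst_liftSub_inst ρ u).symm ▸ hT u hu

theorem Comp.subst_lam (hR : S.FullyApplied R) (hconf : ConfluentOnTypes R) {U B : Ty C F}
    {t : Obj C F} {ρ : ℕ → Obj C F} (hU : CompTy R (U.subst ρ))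
    (ht : ∀ u, Comp S R (U.subst ρ) u →
      Comp S R (B.subst (scons u ρ)) (t.subst (scons u ρ))) :
    Comp S R ((Term.pi U B).subst ρ) ((Term.lam U t).subst ρ) :=
  .lam hR hconf hU fun u hu => by
    rw [Term.subst_liftSub_inst, Term.subst_liftSub_inst]
    exact ht u hu

theorem Comp.subst_app (hR : S.FullyApplied R) (hconf : ConfluentOnTypes R) {U B : Ty C F}
    {t u : Obj C F} {ρ : ℕ → Obj C F} (ht : Comp S R ((Term.pi U B).subst ρ) (t.subst ρ))
    (hu : Comp S R (U.subst ρ) (u.subst ρ)) :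
    Comp S R ((B.inst u).subst ρ) ((Term.app t u).subst ρ) := by
  rw [Term.inst_subst_comm]
  exact ht.app hR hconf hu

theorem kComp_subst_app {T U : Ty C F} {K : Kd C F} {u : Obj C F} {ρ : ℕ → Obj C F}
    (hT : KComp S R (.pi U K) ρ (T.subst ρ)) (hu : Comp S R (U.subst ρ) (u.subst ρ)) :
    KComp S R (K.inst u) ρ ((Term.app T u).subst ρ) := by
  rw [kComp_inst]
  exact hT _ hu

theorem CallComp.comp_subst {g : F .obj} {us : List (Obj C F)} {B : Ty C F} {ρ : ℕ → Obj C F}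
    (h : CallComp S R ⟨.obj, g⟩ (us.map (Term.subst ρ)))
    (hτ : Deriv S R (.ty [] (S.objFn g) .type)) (hlen : us.length = S.arity ⟨.obj, g⟩)
    (hus : TyArgs S R ((S.objFn g).subst ρ) (us.map (Term.subst ρ)) (B.subst ρ)) :
    Comp S R (B.subst ρ) ((apps (.fn g) us).subst ρ) := by
  rw [hτ.ty_subst_eq] at hus
  rw [apps_subst]
  exact h hτ (by rwa [List.length_map]) _ hus

theorem CallComp.compTy_subst {g : F .ty} {us : List (Obj C F)} {ρ : ℕ → Obj C F}
    (h : CallComp S R ⟨.ty, g⟩ (us.map (Term.subst ρ)))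
    (hτ : Deriv S R (.kind [] (S.tyFn g)))
    (hus : KdArgs S R (S.tyFn g) ρ (us.map (Term.subst ρ))) :
    CompTy R ((apps (.fn g) us).subst ρ) := by
  rw [kdArgs_iff_of_closed hτ.kind_subst_eq ρ .var] at hus
  rw [apps_subst]
  exact h hτ hus

theorem Call.length_eq {f g : Sym F} {ps us : List (Obj C F)} {k : ℕ} (h : Call S R f ps k g us) :
    us.length = S.arity g := by
  obtain ⟨-, -, hlen, -⟩ := h
  exact hlen

theorem CC.valid (hR : S.FullyApplied R) (hconf : ConfluentOnTypes R) {f : Sym F}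
    {ps : List (Obj C F)} {σ : ℕ → Obj C F}
    (hvar : ∀ x A, S.LhsVar f ps x A → Comp S R (A.subst σ) (σ x))
    (hcall : ∀ g vs, CallInst S R f ps σ g vs → CallComp S R g vs) {J : CJudg C F}
    (h : CC S R f ps J) : J.Valid S R σ := by
  induction h with
  | @lhsVar Γ x A h =>
    intro ρ hσ _
    rw [Term.shift_subst, Term.subst, hσ, funext hσ]
    exact hvar x A h
  | boundVar h => exact fun ρ _ hρ => hρ _ _ h
  | objCall hc hτ _ ih =>
    intro ρ hσ hρ
    exact (hcall _ _ ⟨_, _, ρ, hc, hσ, rfl⟩).comp_subst hτ hc.length_eq (ih ρ hσ hρ)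
  | tyCall hc hτ _ ih =>
    obtain ⟨rfl, hus⟩ := ih hc.length_eq
    intro ρ hσ hρ
    exact (hcall _ _ ⟨_, _, ρ, hc, hσ, rfl⟩).compTy_subst hτ (hus ρ hσ hρ)
  | tyArgsNil => exact fun ρ _ _ => .nil _
  | tyArgsCons _ _ ihu ihus =>
    exact fun ρ hσ hρ => .cons (ihu ρ hσ hρ) (Term.inst_subst_comm _ _ ρ ▸ ihus ρ hσ hρ)
  | @kdArgsNil Γ K =>
    intro hlen
    cases K with
    | type => exact ⟨rfl, fun _ _ _ => trivial⟩
    | pi U K => cases hlen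
  | @kdArgsCons Γ A K _ u us _ _ ihu ihus =>
    intro hlen
    obtain ⟨rfl, hus⟩ := ihus ((Nat.succ.inj hlen).trans (K.arity_subst _).symm)
    exact ⟨rfl, fun ρ hσ hρ => ⟨ihu ρ hσ hρ, (kdArgs_inst K u ρ _).1 (hus ρ hσ hρ)⟩⟩
  | tyCon D _ => exact fun ρ _ _ => kComp_of_conHeaded hR hconf _ ρ trivial (.con D)
  | tyPi _ _ ihU ihT =>
    exact fun ρ hσ hρ => CompTy.subst_pi hR hconf (ihU ρ hσ hρ) fun u hu => ihT _ hσ (hρ.cons hu)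
  | tyLam _ _ ihU ihT =>
    exact fun ρ hσ hρ => kComp_subst_lam hR hconf (ihU ρ hσ hρ) fun u hu => ihT _ hσ (hρ.cons hu)
  | tyApp _ _ ihT ihu => exact fun ρ hσ hρ => kComp_subst_app (ihT ρ hσ hρ) (ihu ρ hσ hρ)
  | tyConv _ hc ih => exact fun ρ hσ hρ => kComp_eq_of_conv hc ρ ▸ ih ρ hσ hρ
  | objLam _ _ ihU iht =>
    exact fun ρ hσ hρ => .subst_lam hR hconf (ihU ρ hσ hρ) fun u hu => iht _ hσ (hρ.cons hu)
  | objApp _ _ iht ihu => exact fun ρ hσ hρ => (iht ρ hσ hρ).subst_app hR hconf (ihu ρ hσ hρ)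
  | objConv _ hc ih => exact fun ρ hσ hρ => (ih ρ hσ hρ).conv (Conv.subst hc ρ)

/-! ### Computability of calls and of typable terms -/

theorem callComp_obj (hR : S.FullyApplied R) (hconf : ConfluentOnTypes R) (hCC : SatisfiesCC S R)
    {f : F .obj} {ts : List (Obj C F)}
    (hcall : ∀ y, CallRel S R y (⟨.obj, f⟩, ts) → CallComp S R y.1 y.2) :
    CallComp S R ⟨.obj, f⟩ ts := by
  intro hτ hlen B hts
  have hsn : ∀ t ∈ ts, SN R t := hts.sn hR hconf
  refine (isCand_comp hR hconf B).apps_fn hR hlen (terminates_listStep hsn) fun ps r σ hr hps => ?_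
  obtain ⟨B', hargs, hBB'⟩ := hts.red hR hconf (.refl _) hlen.le hps
  rw [← hτ.ty_subst_eq σ] at hargs
  obtain rfl := hargs.eq_resultTy
  have hvar : ∀ x A, AccTy S (S.objFn f) ps x A → Comp S R (A.subst σ) (σ x) :=
    fun _ _ hx => hx.comp hR hconf hargs
  have hvalid := CC.valid (f := ⟨.obj, f⟩) hR hconf hvar
    (fun g vs h => hcall (g, vs) ⟨hsn, ps, σ, hps, h⟩) (hCC.1 f ps r hr)
  exact (hvalid σ (fun _ => rfl) (compEnv_nil σ)).conv hBB'.symm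

theorem callComp_ty (hR : S.FullyApplied R) (hconf : ConfluentOnTypes R) (hCC : SatisfiesCC S R)
    {f : F .ty} {ts : List (Obj C F)}
    (hcall : ∀ y, CallRel S R y (⟨.ty, f⟩, ts) → CallComp S R y.1 y.2) :
    CallComp S R ⟨.ty, f⟩ ts := by
  intro hτ hts
  have hsn : ∀ t ∈ ts, SN R t := hts.sn hR hconf
  refine (isCand_compTy hconf).apps_fn hR hts.length_eq (terminates_listStep hsn)
    fun ps r σ hr hps => ?_
  have hargs : KdArgs S R (S.tyFn f) σ (ps.map (Term.subst σ)) :=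
    (kdArgs_iff_of_closed hτ.kind_subst_eq .var σ _).1 (hts.red hR hconf (fun _ => .refl) hps)
  have hvar : ∀ x A, AccKd S (S.tyFn f) ps x A → Comp S R (A.subst σ) (σ x) :=
    fun _ _ hx => hx.comp hR hconf hargs
  have hvalid := CC.valid (f := ⟨.ty, f⟩) hR hconf hvar
    (fun g vs h => hcall (g, vs) ⟨hsn, ps, σ, hps, h⟩) (hCC.2 f ps r hr)
  exact hvalid σ (fun _ => rfl) (compEnv_nil σ)

theorem callComp (hR : S.FullyApplied R) (hfin : (Defined R).Finite) (hconf : ConfluentOnTypes R)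
    (hCC : SatisfiesCC S R) (hSCT : SizeChangeTerminating S R) (f : Sym F)
    (ts : List (Obj C F)) : CallComp S R f ts := by
  suffices h : ∀ x : Sym F × List (Obj C F), CallComp S R x.1 x.2 from h (f, ts)
  intro x
  induction x using (hSCT.wellFounded_callRel hfin).induction with
  | h x ih =>
    match x, ih with
    | (⟨.obj, _⟩, _), ih => exact callComp_obj hR hconf hCC ih
    | (⟨.ty, _⟩, _), ih => exact callComp_ty hR hconf hCC ih

/-- Validity of typing judgments: computability of the subject under every computable environment,
and termination for kinds. -/
def Judg.Valid (S : Sig C F) (R : Rules C F) : Judg C F → Prop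
  | .ctx _ => True
  | .kind _ K => Terminates (KStep R) K
  | .ty Γ T K => ∀ ρ, CompEnv S R Γ ρ → KComp S R K ρ (T.subst ρ)
  | .obj Γ t A => ∀ ρ, CompEnv S R Γ ρ → Comp S R (A.subst ρ) (t.subst ρ)

theorem terminates_kd_type : Terminates (KStep R) .type :=
  ⟨_, fun _ h => nomatch h⟩

theorem Terminates.kd_pi {U : Ty C F} {K : Kd C F} (hU : SN R U) (hK : Terminates (KStep R) K) :
    Terminates (KStep R) (.pi U K) :=
  hU.map₂ hK fun _ _ _ _ h => match h with
    | .piDom _ hU => .inl ⟨_, hU, rfl⟩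
    | .piCod _ hK => .inr ⟨_, hK, rfl⟩

theorem Deriv.valid (hR : S.FullyApplied R) (hconf : ConfluentOnTypes R)
    (hcall : ∀ g ts, CallComp S R g ts) {J : Judg C F} (h : Deriv S R J) : J.Valid S R := by
  induction h with
  | ctxNil | ctxCons => trivial
  | kindType => exact terminates_kd_type
  | @kindPi Γ U K _ _ ihU ihK =>
    exact .kd_pi (ihU _ (compEnv_var hR hconf Γ)).1.of_subst ihK
  | tyCon D => exact fun ρ _ => kComp_of_conHeaded hR hconf _ ρ trivial (.con D)
  | tyFn f _ hτ =>
    refine fun ρ _ => kComp_of_kdArgs fun us hus => hcall ⟨.ty, f⟩ us hτ ?_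
    exact (kdArgs_iff_of_closed hτ.kind_subst_eq ρ .var us).1 hus
  | tyPi _ _ ihU ihT =>
    exact fun ρ hρ => CompTy.subst_pi hR hconf (ihU ρ hρ) fun u hu => ihT _ (hρ.cons hu)
  | tyLam _ _ ihU ihT =>
    exact fun ρ hρ => kComp_subst_lam hR hconf (ihU ρ hρ) fun u hu => ihT _ (hρ.cons hu)
  | tyApp _ _ ihT ihu => exact fun ρ hρ => kComp_subst_app (ihT ρ hρ) (ihu ρ hρ)
  | tyConv _ _ _ hc ih => exact fun ρ hρ => kComp_eq_of_conv hc ρ ▸ ih ρ hρ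
  | objVar _ h => exact fun ρ hρ => hρ _ _ h
  | objFn f _ hτ _ ihτ =>
    intro ρ _
    obtain ⟨-, P, hP⟩ : CompTy R ((S.objFn f).subst ρ) := ihτ ρ (compEnv_nil ρ)
    rw [hτ.ty_subst_eq] at hP ⊢
    exact .interp hP (hP.of_tyArgs hconf fun us B hlen => hcall ⟨.obj, f⟩ us hτ hlen B)
  | objLam _ _ ihU iht =>
    exact fun ρ hρ => .subst_lam hR hconf (ihU ρ hρ) fun u hu => iht _ (hρ.cons hu)
  | objApp _ _ iht ihu => exact fun ρ hρ => (iht ρ hρ).subst_app hR hconf (ihu ρ hρ)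
  | objConv _ _ _ hc ih => exact fun ρ hρ => (ih ρ hρ).conv (Conv.subst hc ρ)

end LambdaPi

theorem mainTheorem1_general {C : Type u} {F : Lvl → Type v} (S : Sig C F) (R : Rules C F)
    (hR : S.FullyApplied R)
    (hfin : (Defined R).Finite)
    (hconf : ConfluentOnTypes R)
    (hCC : SatisfiesCC S R)
    (hSCT : SizeChangeTerminating S R) :
    (∀ (Γ : List (Ty C F)) (t : Obj C F) (A : Ty C F),
      Deriv S R (.obj Γ t A) → Terminates (Step R) t) ∧
    (∀ (Γ : List (Ty C F)) (T : Ty C F) (K : Kd C F),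
      Deriv S R (.ty Γ T K) → Terminates (Step R) T) ∧
    (∀ (Γ : List (Ty C F)) (K : Kd C F),
      Deriv S R (.kind Γ K) → Terminates (KStep R) K) := by
  have hcall := callComp hR hfin hconf hCC hSCT
  refine ⟨fun Γ t A h => ?_, fun Γ T K h => ?_, fun Γ K h => h.valid hR hconf hcall⟩
  · exact ((isCand_comp hR hconf _).sn
      (h.valid hR hconf hcall _ (compEnv_var hR hconf Γ))).of_subst
  · exact ((isCand_kComp hR hconf _ _).sn
      (h.valid hR hconf hcall _ (compEnv_var hR hconf Γ))).of_subst

theorem mainTheorem1 {C : Type u} {F : Lvl → Type v} (S : Sig C F) (R : Rules C F)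
    (hR : S.IsRewriteSystem R)
    (hfin : (Defined R).Finite)
    (hconf : ∀ l : Lvl, IsConfluent (Step R (l := l)))
    (hpres : PreservesTyping S R)
    (hCC : SatisfiesCC S R)
    (hSCT : SizeChangeTerminating S R) :
    (∀ (Γ : List (Ty C F)) (t : Obj C F) (A : Ty C F),
      Deriv S R (.obj Γ t A) → Terminates (Step R) t) ∧
    (∀ (Γ : List (Ty C F)) (T : Ty C F) (K : Kd C F),
      Deriv S R (.ty Γ T K) → Terminates (Step R) T) ∧
    (∀ (Γ : List (Ty C F)) (K : Kd C F),
      Deriv S R (.kind Γ K) → Terminates (KStep R) K) :=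
  mainTheorem1_general S R (fun _ _ _ _ h => (hR _ _ _ _ h).1) hfin (hconf .ty) hCC hSCT
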